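/- Let $k\in\{3,4,6\}$, let $\zeta_k\in\mathbb{C}$ be a primitive $k$-th root of unity and let $R=\mathbb{Z}[\zeta_k]$. A Hermitian lattice over $R$ is a finitely generated free $R$-module $\Lambda$ with an $R$-valued Hermitian pairing $\star$ (linear in the second variable, conjugate-linear in the first). It is called $\alpha$-modular if $\Lambda=\alpha\Lambda^\vee$ inside $\Lambda\otimes_R\mathbb{C}$, where $\Lambda^\vee=\{w\in\Lambda\otimes_R\mathbb{C}: w\star y\in R\text{ for all }y\in\Lambda\}$ is the Hermitian dual. $U(\Lambda)$ denotes the group of $R$-linear automorphisms of $\Lambda$ preserving $\star$. A vector $e\in\Lambda$ is primitive if $e=ax$ with $a\in R$, $x\in\Lambda$ implies that $a$ is a unit (so $e\neq 0$), and isotropic if $e\star e=0$. Proposition. Let $s\ge 1$ and let $\Lambda$ be a $(1+\zeta_k)$-modular Hermitian lattice over $\mathbb{Z}[\zeta_k]$ of signature $(1,s)$. For every primitive isotropic vector $e\in\Lambda$, the module $e^\perp/\mathbb{Z}[\zeta_k]e$ with the pairing induced by $\star$ is a negative definite $(1+\zeta_k)$-modular Hermitian lattice over $\mathbb{Z}[\zeta_k]$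 of rank $s-1$. The assignment $e\mapsto e^\perp/e$ induces a bijection from the set of $U(\Lambda)$-orbits of primitive isotropic vectors in $\Lambda$ to the set of isometry classes of negative definite $(1+\zeta_k)$-modular Hermitian lattices over $\mathbb{Z}[\zeta_k]$ of rank $s-1$. -/

import Mathlib

open scoped TensorProduct ComplexConjugate

universe u v w

namespace HermLat

/-- The ring `ℤ[ζ]`, as a subring of `ℂ`. -/
abbrev CycInt (ζ : ℂ) : Subalgebra ℤ ℂ := Algebra.adjoin ℤ {ζ}

/-- A Hermitian pairing on an `R`-module `V` with values in the ring `R ⊆ ℂ`: linear in the second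
variable, with `x ⋆ y` the complex conjugate of `y ⋆ x` (so conjugate-linear in the first). -/
structure HermitianForm (R : Subalgebra ℤ ℂ) (V : Type u) [AddCommGroup V] [Module R V] where
  toFun : V → V →ₗ[R] R
  conj_symm : ∀ x y : V, conj (toFun y x : ℂ) = (toFun x y : ℂ)

section Form

variable {R : Subalgebra ℤ ℂ} {V : Type u} [AddCommGroup V] [Module R V]

instance : CoeFun (HermitianForm R V) (fun _ => V → V →ₗ[R] R) := ⟨HermitianForm.toFun⟩

theorem HermitianForm.map_add_left (h : HermitianForm R V) (x y z : V) :
    h (x + y) z = h x z + h y z := by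
  apply Subtype.ext
  push_cast
  rw [← h.conj_symm (x + y) z, ← h.conj_symm x z, ← h.conj_symm y z, map_add]
  push_cast
  rw [map_add]

theorem HermitianForm.coe_smul_left (h : HermitianForm R V) (a : R) (x z : V) :
    (h (a • x) z : ℂ) = conj (a : ℂ) * (h x z : ℂ) := by
  rw [← h.conj_symm (a • x) z, ← h.conj_symm x z, map_smul, smul_eq_mul]
  push_cast
  rw [map_mul]

/-- For `x` in the lattice, the `ℂ`-linear extension of `x ⋆ ·` to `V ⊗ ℂ`. -/
noncomputable def HermitianForm.extendRight (h : HermitianForm R V) (x : V) :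
    ℂ ⊗[R] V →ₗ[ℂ] ℂ :=
  (TensorProduct.AlgebraTensorModule.rid R ℂ ℂ).toLinearMap ∘ₗ (h x).baseChange ℂ

theorem HermitianForm.extendRight_tmul (h : HermitianForm R V) (x y : V) (c : ℂ) :
    h.extendRight x (c ⊗ₜ y) = c * (h x y : ℂ) := by
  simp [HermitianForm.extendRight, Algebra.smul_def, mul_comm]

theorem HermitianForm.extendRight_add (h : HermitianForm R V) (x y : V) (w : ℂ ⊗[R] V) :
    h.extendRight (x + y) w = h.extendRight x w + h.extendRight y w := by
  induction w using TensorProduct.induction_on with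
  | zero => simp
  | tmul c z => simp only [extendRight_tmul, map_add_left]; push_cast; ring
  | add a b ha hb => rw [map_add, map_add, map_add, ha, hb]; ring

theorem HermitianForm.extendRight_smul (h : HermitianForm R V) (a : R) (x : V) (w : ℂ ⊗[R] V) :
    h.extendRight (a • x) w = conj (a : ℂ) * h.extendRight x w := by
  induction w using TensorProduct.induction_on with
  | zero => simp
  | tmul c z => simp only [extendRight_tmul, coe_smul_left]; ring
  | add a b ha hb => rw [map_add, map_add, ha, hb]; ring

/-- The functional `y ↦ w ⋆ y` on the lattice, for `w` in `V ⊗ ℂ`. -/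
noncomputable def HermitianForm.functional (h : HermitianForm R V) (w : ℂ ⊗[R] V) :
    V →ₗ[R] ℂ where
  toFun y := conj (h.extendRight y w)
  map_add' x y := by rw [h.extendRight_add, map_add]
  map_smul' a x := by
    rw [h.extendRight_smul, map_mul, Complex.conj_conj]
    rfl

/-- The Hermitian form on the complex vector space `V ⊗ ℂ` that extends `h`, linear in the second
variable and conjugate-linear in the first. -/
noncomputable def HermitianForm.complexify (h : HermitianForm R V) (w : ℂ ⊗[R] V) :
    ℂ ⊗[R] V →ₗ[ℂ] ℂ :=
  TensorProduct.AlgebraTensorModule.lift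
    ((LinearMap.toSpanSingleton ℂ (V →ₗ[R] ℂ) (h.functional w)))

theorem HermitianForm.complexify_tmul (h : HermitianForm R V) (a b : ℂ) (x y : V) :
    h.complexify (a ⊗ₜ x) (b ⊗ₜ y) = conj a * b * (h x y : ℂ) := by
  simp [HermitianForm.complexify, HermitianForm.functional, extendRight_tmul, h.conj_symm]
  ring

/-- `h` has signature `(r, s)`: the complex vector space `V ⊗ ℂ` has a basis in which the extended
form is `diag(1, …, 1, -1, …, -1)` with `r` entries `1` and `s` entries `-1`. In particular `h` is
nondegenerate. -/
def HermitianForm.HasSignature (h : HermitianForm R V) (r s : ℕ) : Prop :=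
  ∃ b : Module.Basis (Fin r ⊕ Fin s) ℂ (ℂ ⊗[R] V),
    ∀ i j, h.complexify (b i) (b j) =
      Matrix.diagonal (Sum.elim (fun _ => (1 : ℂ)) (fun _ => (-1 : ℂ))) i j

/-- `x ⋆ x < 0` for every nonzero lattice vector (`x ⋆ x` is a real number). -/
def HermitianForm.IsNegDef (h : HermitianForm R V) : Prop :=
  ∀ x : V, x ≠ 0 → (h x x : ℂ).re < 0

/-- The Hermitian dual `V^∨ = {w ∈ V ⊗ ℂ : w ⋆ y ∈ R for all y ∈ V}`. -/
def HermitianForm.dual (h : HermitianForm R V) : Set (ℂ ⊗[R] V) :=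
  {w | ∀ y : V, h.complexify w (1 ⊗ₜ y) ∈ R}

/-- `α`-modularity: `V = α V^∨` inside `V ⊗ ℂ`. -/
def HermitianForm.IsModular (h : HermitianForm R V) (α : ℂ) : Prop :=
  Set.range (fun y : V => (1 : ℂ) ⊗ₜ[R] y) = (fun w => α • w) '' h.dual

/-- The group `U(V)` of `R`-linear automorphisms of `V` that preserve the form. -/
def HermitianForm.isometryGroup (h : HermitianForm R V) : Subgroup (V ≃ₗ[R] V) where
  carrier := {g | ∀ x y, h (g x) (g y) = h x y}
  mul_mem' {a b} ha hb x y := by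
    rw [LinearEquiv.mul_apply, LinearEquiv.mul_apply, ha, hb]
  one_mem' _ _ := rfl
  inv_mem' {a} ha x y := by
    have key : ∀ z, a (a⁻¹ z) = z := fun z => a.apply_symm_apply z
    rw [← ha (a⁻¹ x) (a⁻¹ y), key, key]

/-- A primitive vector: not a multiple of another vector by a non-unit. (Zero is not primitive,
because `0 = 0 • 0`.) -/
def IsPrimitive (e : V) : Prop := ∀ (a : R) (x : V), e = a • x → IsUnit a

/-- The primitive isotropic vectors, with the action of `U(V)` on them. -/
def HermitianForm.primitiveIsotropic (h : HermitianForm R V) :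
    SubMulAction h.isometryGroup V where
  carrier := {e | IsPrimitive (R := R) e ∧ h e e = 0}
  smul_mem' g e he := by
    refine ⟨fun a x hx => he.1 a (g.1⁻¹ x) ?_, ?_⟩
    · have h1 : g.1⁻¹ (g.1 e) = e := g.1.symm_apply_apply e
      have h2 : g.1 e = a • x := hx
      rw [← map_smul, ← h2, h1]
    · exact (g.2 e e).trans he.2

/-- The set of `U(V)`-orbits of primitive isotropic vectors. -/
abbrev HermitianForm.IsotropicOrbits (h : HermitianForm R V) : Type u :=
  MulAction.orbitRel.Quotient h.isometryGroup h.primitiveIsotropic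

/-- The orthogonal complement `e^⊥`. -/
def HermitianForm.perp (h : HermitianForm R V) (e : V) : Submodule R V := LinearMap.ker (h e)

/-- The multiples of `e`, as a submodule of `e^⊥` (when `e` is isotropic). -/
def HermitianForm.lineInPerp (h : HermitianForm R V) (e : V) : Submodule R (h.perp e) :=
  (Submodule.span R {e}).comap (h.perp e).subtype

/-- The quotient `e^⊥ / e`. -/
abbrev HermitianForm.PerpQuot (h : HermitianForm R V) (e : V) : Type u :=
  h.perp e ⧸ h.lineInPerp e

theorem HermitianForm.apply_line_right (h : HermitianForm R V) (e : V) (x z : h.perp e)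
    (hz : z ∈ h.lineInPerp e) : h x.1 z.1 = 0 := by
  obtain ⟨a, ha⟩ := Submodule.mem_span_singleton.1 hz
  have h1 : h x.1 e = 0 := by
    apply Subtype.ext
    rw [← h.conj_symm]
    have : h e x.1 = 0 := x.2
    rw [this]
    simp
  have h2 : a • e = z.1 := ha
  rw [← h2, map_smul, h1, smul_zero]

theorem HermitianForm.apply_line_left (h : HermitianForm R V) (e : V) (x z : h.perp e)
    (hz : z ∈ h.lineInPerp e) : h z.1 x.1 = 0 := by
  apply Subtype.ext
  rw [← h.conj_symm, h.apply_line_right e x z hz]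
  simp

/-- The Hermitian form on `e^⊥ / e` induced by `h`: `[x] ⋆ [y] = x ⋆ y`. -/
def HermitianForm.perpQuotForm (h : HermitianForm R V) (e : V) :
    HermitianForm R (h.PerpQuot e) where
  toFun := fun X => Quotient.liftOn' X
    (fun x => (h.lineInPerp e).liftQ ((h x.1) ∘ₗ (h.perp e).subtype)
      (fun z hz => h.apply_line_right e x z hz))
    (fun x x' hx => by
      have hx' : x - x' ∈ h.lineInPerp e := (Submodule.quotientRel_def _).1 hx
      apply Submodule.linearMap_qext
      ext1 y
      have h0 := h.apply_line_left e y (x - x') hx'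
      have h1 : x.1 = (x - x').1 + x'.1 := by simp
      change h x.1 y.1 = h x'.1 y.1
      rw [h1, h.map_add_left, h0, zero_add])
  conj_symm X Y := by
    induction X using Submodule.Quotient.induction_on with
    | _ x =>
      induction Y using Submodule.Quotient.induction_on with
      | _ y => exact h.conj_symm x.1 y.1

theorem HermitianForm.perpQuotForm_mk (h : HermitianForm R V) (e : V) (x y : h.perp e) :
    h.perpQuotForm e (Submodule.Quotient.mk x) (Submodule.Quotient.mk y) = h x.1 y.1 := rfl

/-- Two Hermitian modules are isometric. -/
def Isometric {W : Type v} [AddCommGroup W] [Module R W]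
    (h : HermitianForm R V) (h' : HermitianForm R W) : Prop :=
  ∃ f : V ≃ₗ[R] W, ∀ x y, h' (f x) (f y) = h x y

end Form

/-- A negative definite `α`-modular Hermitian lattice of rank `n` over `R`. -/
structure NegDefModularLattice (R : Subalgebra ℤ ℂ) (α : ℂ) (n : ℕ) where
  carrier : Type v
  [addCommGroup : AddCommGroup carrier]
  [module : Module R carrier]
  [free : Module.Free R carrier]
  [finite : Module.Finite R carrier]
  form : HermitianForm R carrier
  rank_eq : Module.finrank R carrier = n
  negDef : form.IsNegDef
  modular : form.IsModular α

attribute [instance] NegDefModularLattice.addCommGroup NegDefModularLattice.module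
  NegDefModularLattice.free NegDefModularLattice.finite

/-- Isometry of lattices, as an equivalence relation. -/
def isometrySetoid (R : Subalgebra ℤ ℂ) (α : ℂ) (n : ℕ) :
    Setoid (NegDefModularLattice.{v} R α n) where
  r L M := Isometric L.form M.form
  iseqv :=
    { refl := fun _ => ⟨LinearEquiv.refl _ _, fun _ _ => rfl⟩
      symm := fun ⟨f, hf⟩ => ⟨f.symm, fun x y => by
        rw [← hf, f.apply_symm_apply, f.apply_symm_apply]⟩
      trans := fun ⟨f, hf⟩ ⟨g, hg⟩ => ⟨f.trans g, fun x y => by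
        rw [LinearEquiv.trans_apply, LinearEquiv.trans_apply, hg, hf]⟩ }

/-- The set of isometry classes of negative definite `α`-modular lattices of rank `n` over `R`. -/
abbrev IsometryClasses (R : Subalgebra ℤ ℂ) (α : ℂ) (n : ℕ) : Type (v + 1) :=
  Quotient (isometrySetoid.{v} R α n)

end HermLat

/-! Write R = ℤ[ζ], α = 1 + ζ and t = ζ + ζ̄ ∈ {-1, 0, 1}. Then αᾱ = α + ᾱ = p with p = 2 + t ∈ {1,
2, 3}, and ᾱ is a unit times α. Modularity says that the functionals y ⋆ · with y in the lattice are
exactly α Hom(Λ, R) (`isModular_iff_perfect`). Signature (1, s) is used mostly through a positive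
vector with negative definite complement (`HasSignature.lorentzian`).

Injectivity is a splitting argument. For e primitive isotropic, modularity gives f with e ⋆ f = α.
As p divides f ⋆ f and α + ᾱ = p, an integer multiple of e corrects f to be isotropic. The plane ⟨e,
f⟩ splits off, and its complement M is isometric to e^⊥/e (`Perfect.exists_hypSum`,
`isometric_perpQuot`). An isometry between two such complements extends over the hyperbolic planes
and carries e to e'.

Surjectivity: adding a hyperbolic plane to L gives a modular lattice with the positivity property
and the rank of Λ, so it suffices that such a lattice V of rank at least 2 is determined by its rank
(`isometric_of_finrank_eq`). Take X maximal between αV and V such that p divides the form on X,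
containing a vector that makes the form divided by p odd. That form is unimodular on X, and
multiplication by α embeds V isometrically as a Lagrangian of X modulo α
(`Perfect.exists_overlattice`). Now X is unique: it has isotropic vectors, by a descent on ternary
forms (`exists_norm_eq`) or a determinant computation in rank two, and these allow vectors of norm
-1 to be split off one by one (`exists_orthogonal_basis`). Finally the unitary group of X is
transitive on Lagrangians, since enough transvections modulo α lift to isometries
(`exists_isometry_map_eq`). -/

namespace HermLat

/-- A subring of `ℂ` that is stable under conjugation, has only integers as real elements, is
Euclidean for the norm, and whose norm form is onto modulo every rational prime that is not itself
a norm. -/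
class NormEuclidean (R : Subalgebra ℤ ℂ) where
  cj : R →+* R
  coe_cj : ∀ r : R, (cj r : ℂ) = conj (r : ℂ)
  real_int : ∀ r : R, cj r = r → ∃ n : ℤ, (n : R) = r
  approx : ∀ z : ℂ, ∃ r : R, Complex.normSq (z - r) ≤ 1 / 2
  norm_residue : ∀ p : ℕ, p.Prime → (∃ r : R, r * cj r = (p : R)) ∨
    ∀ a : ℤ, ∃ (t : R) (m : ℤ), t * cj t = (a : R) + (p : R) * (m : R)
  trace_parity : ∀ n : ℤ, (∃ a : R, (n : R) = a + cj a) ∨ (∃ a : R, (n : R) = 1 + (a + cj a))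

/-! ### Norms and Euclidean division in R. -/

open NormEuclidean (cj)

section Arith

variable {R : Subalgebra ℤ ℂ} [NormEuclidean R]

@[simp] theorem cj_cj (r : R) : cj (cj r) = r := by
  apply Subtype.ext
  rw [NormEuclidean.coe_cj, NormEuclidean.coe_cj, Complex.conj_conj]

theorem exists_norm (r : R) : ∃ n : ℤ, (n : R) = r * cj r :=
  NormEuclidean.real_int _ (by rw [map_mul, cj_cj, mul_comm])

/-- The norm `r * cj r`, as an integer. -/
noncomputable def nrm (r : R) : ℤ := (exists_norm r).choose

theorem coe_nrm (r : R) : (nrm r : R) = r * cj r := (exists_norm r).choose_spec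

omit [NormEuclidean R] in
theorem intCast_inj' {m n : ℤ} : (m : R) = n ↔ m = n := Int.cast_inj

theorem coe_nrm_real (r : R) : (nrm r : ℝ) = Complex.normSq (r : ℂ) := by
  have h := congrArg (fun x : R => (x : ℂ)) (coe_nrm r)
  simp only [MulMemClass.coe_mul, NormEuclidean.coe_cj, Complex.mul_conj] at h
  have h2 : ((nrm r : R) : ℂ) = ((nrm r : ℝ) : ℂ) := by push_cast; rfl
  rw [h2] at h
  exact_mod_cast h

theorem nrm_nonneg (r : R) : 0 ≤ nrm r := by
  have : (0 : ℝ) ≤ nrm r := by rw [coe_nrm_real]; exact Complex.normSq_nonneg _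
  exact_mod_cast this

theorem nrm_eq_zero {r : R} : nrm r = 0 ↔ r = 0 := by
  have : nrm r = 0 ↔ (nrm r : ℝ) = 0 := by norm_cast
  rw [this, coe_nrm_real, Complex.normSq_eq_zero]
  exact_mod_cast Iff.rfl

theorem nrm_pos {r : R} (hr : r ≠ 0) : 0 < nrm r :=
  lt_of_le_of_ne (nrm_nonneg r) (fun h => hr (nrm_eq_zero.1 h.symm))

@[simp] theorem nrm_zero : nrm (0 : R) = 0 := nrm_eq_zero.2 rfl

theorem nrm_mul (a b : R) : nrm (a * b) = nrm a * nrm b := by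
  rw [← intCast_inj' (R := R)]
  push_cast
  simp only [coe_nrm, map_mul]
  ring

@[simp] theorem nrm_intCast (n : ℤ) : nrm (n : R) = n ^ 2 := by
  rw [← intCast_inj' (R := R), coe_nrm, map_intCast]
  push_cast
  ring

theorem cj_ne_zero {r : R} (hr : r ≠ 0) : cj r ≠ 0 := fun h => hr (by
  rw [← cj_cj r, h, map_zero])

theorem exists_quotient (a b : R) (hb : b ≠ 0) : ∃ q : R, 2 * nrm (a - b * q) ≤ nrm b := by
  obtain ⟨q, hq⟩ := NormEuclidean.approx (R := R) ((a : ℂ) / b)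
  refine ⟨q, ?_⟩
  have hb' : (b : ℂ) ≠ 0 := fun h => hb (Subtype.ext h)
  have e : ((a - b * q : R) : ℂ) = b * ((a : ℂ) / b - q) := by
    push_cast
    field_simp
  have : (2 * nrm (a - b * q) : ℝ) ≤ nrm b := by
    rw [coe_nrm_real, coe_nrm_real, e, Complex.normSq_mul]
    nlinarith [Complex.normSq_nonneg (b : ℂ)]
  exact_mod_cast this

/-- A nonzero element of least norm generates the ideal, because `exists_quotient` leaves a
remainder of strictly smaller norm. -/
instance : IsPrincipalIdealRing R where
  principal I := by
    classical
    by_cases hI : I = ⊥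
    · exact hI ▸ bot_isPrincipal
    obtain ⟨x, hx, hx0⟩ := Submodule.exists_mem_ne_zero_of_ne_bot hI
    let P : ℕ → Prop := fun n => ∃ x ∈ I, x ≠ 0 ∧ (nrm x).toNat = n
    have hP : ∃ n, P n := ⟨_, x, hx, hx0, rfl⟩
    obtain ⟨b, hb, hb0, hbn⟩ := Nat.find_spec hP
    refine ⟨b, le_antisymm (fun a ha => ?_) ((Submodule.span_singleton_le_iff_mem _ _).2 hb)⟩
    obtain ⟨q, hq⟩ := exists_quotient a b hb0
    have hpos := nrm_pos hb0
    have hz : a - b * q = 0 := by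
      by_contra hne
      refine Nat.find_min hP (m := (nrm (a - b * q)).toNat) ?_
        ⟨a - b * q, I.sub_mem ha (I.mul_mem_right _ hb), hne, rfl⟩
      have := nrm_pos hne
      omega
    exact Submodule.mem_span_singleton.2 ⟨q, by rw [smul_eq_mul]; linear_combination -hz⟩

end Arith

/-! ### Hermitian forms over R: integral norms, positivity and duality. -/

section Form

variable {R : Subalgebra ℤ ℂ} [NormEuclidean R] {V : Type u} [AddCommGroup V] [Module R V]
  (h : HermitianForm R V)

namespace HermitianForm

theorem cj_apply (x y : V) : cj (h x y) = h y x :=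
  Subtype.ext (by rw [NormEuclidean.coe_cj, h.conj_symm])

theorem smul_left (a : R) (x y : V) : h (a • x) y = cj a * h x y := by
  rw [← h.cj_apply y, map_smul, smul_eq_mul, map_mul, h.cj_apply]

theorem zero_left (y : V) : h 0 y = 0 := by
  rw [← h.cj_apply y, map_zero, map_zero]

theorem neg_left (x y : V) : h (-x) y = - h x y := by
  rw [← h.cj_apply y, map_neg, map_neg, h.cj_apply]

theorem sub_left (x y z : V) : h (x - y) z = h x z - h y z := by
  rw [sub_eq_add_neg, h.map_add_left, h.neg_left, sub_eq_add_neg]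

theorem exists_sq (x : V) : ∃ n : ℤ, (n : R) = h x x :=
  NormEuclidean.real_int _ (h.cj_apply x x)

/-- The integer `x ⋆ x`. -/
noncomputable def sq (x : V) : ℤ := (h.exists_sq x).choose

theorem coe_sq (x : V) : (h.sq x : R) = h x x := (h.exists_sq x).choose_spec

theorem sq_eq {x : V} {n : ℤ} (hn : h x x = n) : h.sq x = n := by
  rw [← intCast_inj' (R := R), h.coe_sq, hn]

theorem sq_zero : h.sq 0 = 0 := h.sq_eq (by simp)

theorem coe_sq_re (x : V) : (h.sq x : ℝ) = (h x x : ℂ).re := by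
  have := congrArg (fun x : R => (x : ℂ).re) (h.coe_sq x)
  simpa using this

/-- `x ⋆ y` vanishes iff `y ⋆ x` does. -/
theorem apply_eq_zero_comm {x y : V} (H : h x y = 0) : h y x = 0 := by
  rw [← h.cj_apply, H, map_zero]

theorem isNegDef_iff : h.IsNegDef ↔ ∀ x, x ≠ 0 → h.sq x < 0 := by
  refine forall_congr' fun x => imp_congr_right fun _ => ?_
  rw [← h.coe_sq_re]
  norm_cast

/-- `h` takes values in `αR` and induces, after division by `α`, all functionals. -/
def Perfect (α : R) : Prop :=
  (∀ x y, α ∣ h x y) ∧ ∀ φ : V →ₗ[R] R, ∃ y, ∀ x, h y x = α * φ x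

/-- There is a positive vector with negative definite orthogonal complement. -/
def Lorentzian : Prop :=
  ∃ v, 0 < h.sq v ∧ ∀ y, h v y = 0 → y ≠ 0 → h.sq y < 0

/-- The restriction of a form to a submodule. -/
def restrict (N : Submodule R V) : HermitianForm R N where
  toFun x := (h x.1) ∘ₗ N.subtype
  conj_symm x y := h.conj_symm x.1 y.1

omit [NormEuclidean R] in
@[simp] theorem restrict_apply (N : Submodule R V) (x y : N) : h.restrict N x y = h x.1 y.1 := rfl

@[simp] theorem restrict_sq (N : Submodule R V) (x : N) : (h.restrict N).sq x = h.sq x.1 :=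
  sq_eq _ (by rw [restrict_apply, coe_sq])

theorem sq_smul_add_smul (a b : R) (x y : V) (hxy : h x y = 0) :
    h.sq (a • x + b • y) = nrm a * h.sq x + nrm b * h.sq y := by
  apply h.sq_eq
  push_cast
  simp only [coe_nrm, coe_sq, map_add_left, smul_left, map_add, map_smul, smul_eq_mul, hxy,
    h.apply_eq_zero_comm hxy]
  ring

theorem sq_smul (a : R) (x : V) : h.sq (a • x) = nrm a * h.sq x := by
  apply h.sq_eq
  push_cast
  simp only [coe_nrm, coe_sq, smul_left, map_smul, smul_eq_mul]
  ring

variable {h}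

/-- Any positive vector can replace the given v. If x ⋆ x > 0, y ⟂ x and y ⋆ y ≥ 0, the form is
nonnegative on the span of x and y, but that span contains (v ⋆ y) x - (v ⋆ x) y, which is
orthogonal to v. -/
theorem Lorentzian.sq_neg (H : h.Lorentzian) {x y : V} (hx : 0 < h.sq x) (hxy : h x y = 0)
    (hy : y ≠ 0) : h.sq y < 0 := by
  obtain ⟨v, hv, hneg⟩ := H
  by_contra hc
  push Not at hc
  have key : h.sq (h v y • x + (-h v x) • y) = nrm (h v y) * h.sq x + nrm (-h v x) * h.sq y :=
    h.sq_smul_add_smul _ _ x y hxy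
  have hz : h v y • x + (-h v x) • y = 0 := by
    by_contra hne
    have := hneg _ (by simp only [map_add, map_smul, smul_eq_mul]; ring) hne
    have h1 := mul_nonneg (nrm_nonneg (h v y)) hx.le
    have h2 := mul_nonneg (nrm_nonneg (-h v x)) hc
    omega
  have hvy : h v y = 0 := by
    have h1 := congrArg (h x) hz
    simp only [map_add, map_smul, smul_eq_mul, hxy, mul_zero, add_zero, map_zero] at h1
    rcases mul_eq_zero.1 h1 with h2 | h2
    · exact h2
    · rw [← h.coe_sq] at h2
      have : h.sq x = 0 := by exact_mod_cast h2
      omega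
  have := hneg y hvy hy
  omega

theorem Lorentzian.restrict (H : h.Lorentzian) (N : Submodule R V) {x : V} (hx : x ∈ N)
    (hpos : 0 < h.sq x) : (h.restrict N).Lorentzian :=
  ⟨⟨x, hx⟩, by simpa using hpos, fun y hy hne => by
    rw [restrict_sq]
    exact H.sq_neg hpos hy (fun h0 => hne (Subtype.ext h0))⟩

theorem Perfect.eq_zero [Module.Free R V] {α : R} (hα : α ≠ 0) (H : h.Perfect α) {x : V}
    (hx : ∀ y, h x y = 0) : x = 0 := by
  have b := Module.Free.chooseBasis R V
  rw [← b.forall_coord_eq_zero_iff (x := x)]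
  intro i
  obtain ⟨y, hy⟩ := H.2 (b.coord i)
  have h1 := hy x
  rw [h.apply_eq_zero_comm (hx y)] at h1
  exact (mul_eq_zero.1 h1.symm).resolve_left hα

/-- Over a principal ideal domain, a nonzero vector is a multiple of one on which the pairing
takes the least possible value. -/
theorem Perfect.exists_dual [Module.Free R V] {α : R} (hα : α ≠ 0) (H : h.Perfect α) {e : V}
    (he : e ≠ 0) : ∃ (g : R) (e' f : V), e = g • e' ∧ h e' f = α := by
  have hdiv : ∀ x, ∃ c, h e x = α * c := fun x => H.1 e x
  choose c hc using hdiv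
  let ψ : V →ₗ[R] R :=
    { toFun := c
      map_add' := fun x y => mul_left_cancel₀ hα (by
        rw [← hc, mul_add, ← hc, ← hc, map_add])
      map_smul' := fun a x => mul_left_cancel₀ hα (by
        rw [← hc, map_smul, hc, smul_eq_mul, smul_eq_mul, RingHom.id_apply]; ring) }
  have hψ : ∀ x, h e x = α * ψ x := hc
  -- With g a generator of the values of ψ = (e ⋆ ·)/α, the functional ψ/g is onto R, and the vector
  -- representing it is e divided by ḡ; the conjugate appears because the form is conjugate-linear
  -- on the left.
  obtain ⟨g, hg⟩ := (IsPrincipalIdealRing.principal (LinearMap.range ψ)).principal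
  have hg0 : g ≠ 0 := by
    rintro rfl
    refine he (H.eq_zero hα fun y => ?_)
    have : ψ y ∈ LinearMap.range ψ := ⟨y, rfl⟩
    rw [hg, Submodule.mem_span_singleton] at this
    obtain ⟨a, ha⟩ := this
    rw [hψ, ← ha, smul_zero, mul_zero]
  have hdvd : ∀ x, ∃ d, ψ x = g * d := fun x => by
    have : ψ x ∈ LinearMap.range ψ := ⟨x, rfl⟩
    rw [hg, Submodule.mem_span_singleton] at this
    obtain ⟨a, ha⟩ := this
    exact ⟨a, by rw [← ha, smul_eq_mul, mul_comm]⟩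
  choose d hd using hdvd
  let φ : V →ₗ[R] R :=
    { toFun := d
      map_add' := fun x y => mul_left_cancel₀ hg0 (by
        rw [← hd, mul_add, ← hd, ← hd, map_add])
      map_smul' := fun a x => mul_left_cancel₀ hg0 (by
        rw [← hd, map_smul, hd, smul_eq_mul, smul_eq_mul, RingHom.id_apply]; ring) }
  obtain ⟨y, hy⟩ := H.2 φ
  have hgm : g ∈ LinearMap.range ψ := by
    rw [hg]; exact Submodule.mem_span_singleton_self g
  obtain ⟨f, hf⟩ := hgm
  refine ⟨cj g, y, f, ?_, ?_⟩
  · rw [← sub_eq_zero]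
    refine H.eq_zero hα fun x => ?_
    rw [h.sub_left, h.smul_left, cj_cj, hψ, hy, hd]
    change α * (g * d x) - g * (α * d x) = 0
    ring
  · rw [hy]
    have : g * φ f = g * 1 := by
      change g * d f = _
      rw [← hd, hf, mul_one]
    rw [mul_left_cancel₀ hg0 this, mul_one]

end HermitianForm

end Form

end HermLat

/-! ### Isotropy of the ternary forms ⟨1, -a, -b⟩ by descent. -/

namespace HermLat

open NormEuclidean (cj)

section Ternary

variable (R : Subalgebra ℤ ℂ) [NormEuclidean R]

/-- The binary Hermitian form `⟨1, -a⟩` over the fraction field of `R` represents `m`. -/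
def Represents (a m : ℤ) : Prop :=
  ∃ x y z : R, z ≠ 0 ∧ x * cj x - a * (y * cj y) = m * (z * cj z)

variable {R}

/-- The values are reduced norms of the quaternions x + yj with j² = a and ju = ūj, so they
multiply; the witness is the quaternion product. -/
theorem Represents.mul {a m n : ℤ} (hm : Represents R a m) (hn : Represents R a n) :
    Represents R a (m * n) := by
  obtain ⟨x, y, z, hz, e⟩ := hm
  obtain ⟨u, v, w, hw, e'⟩ := hn
  refine ⟨x * u + a * (y * cj v), x * v + y * cj u, z * w, mul_ne_zero hz hw, ?_⟩
  simp only [map_mul, map_add, cj_cj, map_intCast]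
  push_cast
  linear_combination (u * cj u - a * (v * cj v)) * e + m * (z * cj z) * e'

theorem Represents.of_mul_left {a m n : ℤ} (h : Represents R a (m * n)) (hm : Represents R a m)
    (hm0 : m ≠ 0) : Represents R a n := by
  obtain ⟨x, y, z, hz, e⟩ := h.mul hm
  refine ⟨x, y, m * z, mul_ne_zero (by exact_mod_cast hm0) hz, ?_⟩
  rw [e, map_mul, map_intCast]
  push_cast
  ring

theorem represents_one (a : ℤ) : Represents R a 1 := ⟨1, 0, 1, one_ne_zero, by simp⟩

theorem represents_norm (a : ℤ) {m : ℤ} {t : R} (h : t * cj t = m) : Represents R a m :=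
  ⟨t, 0, 1, one_ne_zero, by simp [h]⟩

/-- If `a` is a norm, then `⟨1, -a⟩` is isotropic, hence universal. -/
theorem represents_of_norm {a : ℤ} {t : R} (h : t * cj t = a) (ha : a ≠ 0) (m : ℤ) :
    Represents R a m := by
  have ht : t ≠ 0 := by
    rintro rfl
    rw [zero_mul] at h
    exact ha (by exact_mod_cast h.symm)
  -- This is (m + 1)² - (m - 1)² = 4m, multiplied by a = t t̄.
  refine ⟨t * (m + 1), m - 1, 2 * t, mul_ne_zero two_ne_zero ht, ?_⟩
  simp only [map_mul, map_add, map_sub, map_intCast, map_one, map_ofNat]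
  linear_combination ((m + 1) ^ 2 - 4 * m : R) * h

/-- Both sides express that ⟨1, -a, -b⟩ is isotropic. When y = 0 the solution cannot be rearranged,
but then b is a norm from the fraction field and ⟨1, -b⟩ is universal. -/
theorem Represents.symm {a b : ℤ} (hb : b ≠ 0) (h : Represents R a b) :
    Represents R b a := by
  obtain ⟨x, y, z, hz, e⟩ := h
  by_cases hy : y = 0
  · subst hy
    have e' : x * cj x = b * (z * cj z) := by linear_combination e
    have hx : x ≠ 0 := by
      rintro rfl
      have hb' : (b : R) ≠ 0 := by exact_mod_cast hb
      exact mul_ne_zero hb' (mul_ne_zero hz (cj_ne_zero hz)) (by rw [← e', zero_mul])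
    refine ⟨(a + 1) * x, (a - 1) * z, 2 * x, mul_ne_zero two_ne_zero hx, ?_⟩
    simp only [map_mul, map_add, map_sub, map_intCast, map_one, map_ofNat]
    linear_combination ((a - 1) ^ 2 : R) * e'
  · exact ⟨x, z, y, hy, by linear_combination e⟩

/-- The descent step for a prime. -/
theorem represents_prime {a : ℤ} {p : ℕ} (hp : p.Prime) (ha0 : a ≠ 0) (hap : |a| < p)
    (ih : ∀ r : ℤ, 0 < r → r < p → Represents R a r) : Represents R a p := by
  rcases NormEuclidean.norm_residue (R := R) p hp with ⟨r, hr⟩ | hres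
  · exact represents_norm a (t := r) (by rw [hr]; simp)
  obtain ⟨t₀, m₀, ht₀⟩ := hres a
  have hp0 : (p : R) ≠ 0 := by exact_mod_cast hp.ne_zero
  -- Reducing t₀ modulo p gives t with N(t) ≡ a mod p and N(t) ≤ p²/2. Writing N(t) = a + pr, the
  -- bound |a| < p forces 0 ≤ r < p. So rp = N(t) - a is represented, and r is by induction unless r
  -- = 0, when a is itself a norm.
  obtain ⟨q, hq⟩ := exists_quotient t₀ (p : R) hp0
  set t := t₀ - p * q with ht
  obtain ⟨τ, hτ⟩ : ∃ τ : ℤ, (τ : R) = t₀ * cj q + cj t₀ * q :=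
    NormEuclidean.real_int _ (by simp only [map_add, map_mul, cj_cj]; ring)
  have hpn : nrm (p : R) = (p : ℤ) ^ 2 := by
    have := nrm_intCast (R := R) (p : ℤ)
    simpa using this
  have e : t * cj t = (a : R) + (p : R) * ((m₀ - τ + p * nrm q : ℤ) : R) := by
    push_cast
    rw [hτ, coe_nrm, ht]
    simp only [map_sub, map_mul, map_natCast]
    linear_combination ht₀
  set r := m₀ - τ + p * nrm q with hr
  have eZ : nrm t = a + p * r := by
    rw [← intCast_inj' (R := R), coe_nrm, e]
    push_cast
    ring
  have hp2 : (2 : ℤ) ≤ p := by exact_mod_cast hp.two_le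
  rw [hpn] at hq
  have habs := abs_lt.1 hap
  have hn := nrm_nonneg t
  have hr0 : 0 ≤ r := by
    by_contra hneg
    have : r ≤ -1 := by omega
    nlinarith
  have hrp : r < p := by
    by_contra hge
    push Not at hge
    nlinarith
  rcases hr0.eq_or_lt with h0 | hpos
  · rw [← h0] at e
    exact represents_of_norm (t := t) (by rw [e]; simp) ha0 p
  · have h1 : Represents R a (r * p) :=
      ⟨t, 1, 1, one_ne_zero, by rw [e]; push_cast; simp; ring⟩
    exact h1.of_mul_left (ih r hpos hrp) hpos.ne'

/-- Composite b follow from multiplicativity and prime b from the descent step, which applies as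
|-1| < b. This case comes first because `represents_pos` needs it when a = b. -/
theorem represents_neg_one (b : ℕ) (hb : 0 < b) : Represents R (-1) b := by
  induction b using Nat.strong_induction_on with
  | _ b ih =>
    rcases Nat.lt_or_ge 1 b with h1 | h1
    · by_cases hp : b.Prime
      · refine represents_prime hp (by norm_num) (by simpa using h1) fun r hr hrb => ?_
        lift r to ℕ using hr.le
        exact ih r (by exact_mod_cast hrb) (by exact_mod_cast hr)
      · obtain ⟨c, hc, hc1, hcb⟩ := Nat.exists_dvd_of_not_prime2 h1 hp
        obtain ⟨d, rfl⟩ := hc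
        have hd : 0 < d := by
          rcases Nat.eq_zero_or_pos d with h0 | h0
          · subst h0; omega
          · exact h0
        push_cast
        exact (ih c hcb (by omega)).mul (ih d (by nlinarith) hd)
    · have : b = 1 := by omega
      subst this
      exact_mod_cast represents_one (R := R) (-1)

/-- Induction on a bound for a + b. Composite b factors, prime b > a descends, and a > b is reduced
to these by symmetry. -/
theorem represents_pos (n : ℕ) : ∀ a b : ℕ, 0 < a → 0 < b → a + b ≤ n →
    Represents R (a : ℤ) (b : ℤ) := by
  induction n with
  | zero => intro a b ha hb h; omega
  | succ n ih =>
    have comp : ∀ a b : ℕ, 0 < a → 1 < b → ¬ b.Prime → a + b ≤ n + 1 →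
        Represents R (a : ℤ) (b : ℤ) := by
      intro a b ha h1 hp hab
      obtain ⟨c, hc, hc1, hcb⟩ := Nat.exists_dvd_of_not_prime2 h1 hp
      obtain ⟨d, rfl⟩ := hc
      have hd : 0 < d := by
        rcases Nat.eq_zero_or_pos d with h0 | h0
        · subst h0; omega
        · exact h0
      have hdb : d < c * d := by nlinarith
      push_cast
      exact (ih a c ha (by omega) (by omega)).mul (ih a d ha hd (by omega))
    have prim : ∀ a b : ℕ, 0 < a → a < b → b.Prime → a + b ≤ n + 1 →
        Represents R (a : ℤ) (b : ℤ) := by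
      intro a b ha hlt hp hab
      refine represents_prime hp (by omega) (by simpa using hlt) fun r hr hrb => ?_
      lift r to ℕ using hr.le
      exact ih a r ha (by exact_mod_cast hr) (by omega)
    intro a b ha hb hab
    rcases Nat.lt_or_ge 1 b with h1 | h1
    swap
    · have : b = 1 := by omega
      subst this
      exact_mod_cast represents_one (R := R) a
    by_cases hp : b.Prime
    swap
    · exact comp a b ha h1 hp hab
    rcases lt_trichotomy a b with hlt | heq | hgt
    · exact prim a b ha hlt hp hab
    · subst heq
      -- For a = b the descent bound |a| < p fails; instead a = (-1)(-a), where -a is a value of ⟨1,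
      -- -a⟩ at (0, 1) and -1 is one by symmetry with ⟨1, 1⟩.
      have hm1 : Represents R (a : ℤ) (-1) :=
        (represents_neg_one a ha).symm (by omega)
      have hm2 : Represents R (a : ℤ) (-(a : ℤ)) := ⟨0, 1, 1, one_ne_zero, by simp⟩
      have := hm1.mul hm2
      simpa using this
    · refine Represents.symm (by omega) ?_
      by_cases ha' : a.Prime
      · exact prim b a hb hgt ha' (by omega)
      · exact comp b a hb (by omega) ha' (by omega)

/-- Over an imaginary quadratic field with Euclidean ring of integers, `⟨1, -a, -b⟩` is isotropic
for positive `a`, `b`. -/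
theorem exists_norm_eq {a b : ℤ} (ha : 0 < a) (hb : 0 < b) :
    ∃ x y z : R, z ≠ 0 ∧ x * cj x - a * (y * cj y) = b * (z * cj z) := by
  lift a to ℕ using ha.le
  lift b to ℕ using hb.le
  exact represents_pos (a + b) a b (by exact_mod_cast ha) (by exact_mod_cast hb) le_rfl

end Ternary

end HermLat

/-! ### Uniqueness of odd unimodular lattices of signature (1, n). -/

namespace HermLat

open NormEuclidean (cj)

section Unimodular

variable {R : Subalgebra ℤ ℂ} [NormEuclidean R] {V : Type u} [AddCommGroup V] [Module R V]
  {h : HermitianForm R V}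

namespace HermitianForm

omit [NormEuclidean R] in
theorem exists_ne_zero_of_finrank_lt {W : Type*} [AddCommGroup W] [Module R W] [Module.Free R W]
    [Module.Finite R W] [Module.Finite R V]
    (φ : V →ₗ[R] W) (hlt : Module.finrank R W < Module.finrank R V) : ∃ x, x ≠ 0 ∧ φ x = 0 := by
  by_contra hc
  push Not at hc
  have hinj : Function.Injective φ := (injective_iff_map_eq_zero φ).2 fun x hx => by
    by_contra hne
    exact hc x hne hx
  have := LinearMap.finrank_le_finrank_of_injective hinj
  omega

theorem Lorentzian.exists_isotropic [Module.Finite R V] (H : h.Lorentzian)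
    (hrk : 3 ≤ Module.finrank R V) : ∃ e, e ≠ 0 ∧ h e e = 0 := by
  obtain ⟨v, hv, hneg⟩ := H
  obtain ⟨u, hu0, hu⟩ := exists_ne_zero_of_finrank_lt (h v) (by
    rw [Module.finrank_self]; omega)
  obtain ⟨w, hw0, hw⟩ := exists_ne_zero_of_finrank_lt ((h v).prod (h u)) (by
    rw [Module.finrank_prod, Module.finrank_self]; omega)
  have hvw : h v w = 0 := congrArg Prod.fst hw
  have huw : h u w = 0 := congrArg Prod.snd hw
  have hb := hneg u hu hu0
  have hc := hneg w hvw hw0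
  -- Multiplying the diagonal form on v, u, w by v ⋆ v brings it, up to squares, to ⟨1, -a, -b⟩ with
  -- a, b > 0.
  obtain ⟨x, y, z, hz, e⟩ := exists_norm_eq (R := R) (a := h.sq v * -h.sq u)
    (b := h.sq v * -h.sq w) (by nlinarith) (by nlinarith)
  push_cast [coe_sq] at e
  have ha : h v v ≠ 0 := by
    rw [← coe_sq]
    exact_mod_cast hv.ne'
  have hw' : h w w ≠ 0 := by
    rw [← coe_sq]
    exact_mod_cast hc.ne
  have huv := h.apply_eq_zero_comm hu
  have hwv := h.apply_eq_zero_comm hvw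
  have hwu := h.apply_eq_zero_comm huw
  refine ⟨x • v + (h v v * y) • u + (h v v * z) • w, fun h0 => ?_, ?_⟩
  · have := congrArg (h w) h0
    simp only [map_add, map_smul, smul_eq_mul, hwv, hwu, map_zero, mul_zero, zero_add] at this
    exact mul_ne_zero (mul_ne_zero ha hz) hw' this
  · simp only [map_add, map_smul, smul_eq_mul, map_add_left, smul_left, map_mul, h.cj_apply,
      hwv, hwu, hu, hvw, huw, huv]
    linear_combination (h v v) * e

theorem Lorentzian.exists_isotropic_of_rank_two [Module.Free R V] [Module.Finite R V]
    (H : h.Lorentzian) (P : h.Perfect 1) (hrk : Module.finrank R V = 2) :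
    ∃ e, e ≠ 0 ∧ h e e = 0 := by
  let b : Module.Basis (Fin 2) R V := Module.finBasisOfFinrankEq R V hrk
  set p := h.sq (b 0) with hp
  set r := h.sq (b 1) with hr
  set q := h (b 0) (b 1) with hq
  have h00 : h (b 0) (b 0) = p := (h.coe_sq _).symm
  have h11 : h (b 1) (b 1) = r := (h.coe_sq _).symm
  have h10 : h (b 1) (b 0) = cj q := (h.cj_apply _ _).symm
  by_cases hp0 : p = 0
  · exact ⟨b 0, b.ne_zero 0, by rw [h00, hp0, Int.cast_zero]⟩
  have expand : ∀ x : V, x = b.repr x 0 • b 0 + b.repr x 1 • b 1 := fun x => by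
    conv_lhs => rw [← b.sum_repr x, Fin.sum_univ_two]
  set D := nrm q - p * r with hD
  have hDR : (D : R) = q * cj q - p * r := by
    rw [hD]; push_cast; rw [coe_nrm]
  -- Completing the square; D is minus the determinant of the Gram matrix.
  have key : ∀ x : V, p * h.sq x =
      nrm ((p : R) * b.repr x 0 + q * b.repr x 1) - D * nrm (b.repr x 1) := by
    intro x
    rw [← intCast_inj' (R := R)]
    push_cast
    rw [hDR, h.coe_sq x, coe_nrm, coe_nrm]
    have hx : h x x = h (b.repr x 0 • b 0 + b.repr x 1 • b 1)
        (b.repr x 0 • b 0 + b.repr x 1 • b 1) := by rw [← expand x]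
    rw [hx]
    simp only [map_add, map_smul, smul_eq_mul, map_add_left, smul_left, h00, h11, h10, ← hq,
      map_mul, map_intCast]
    ring
  -- The vectors dual to the basis provide an inverse of the Gram matrix, so D is a unit of R;
  -- taking norms makes it a unit of ℤ.
  have hunit : D = 1 ∨ D = -1 := by
    obtain ⟨y, hy⟩ := P.2 (b.coord 0)
    obtain ⟨z, hz⟩ := P.2 (b.coord 1)
    have y0 := hy (b 0)
    have y1 := hy (b 1)
    have z0 := hz (b 0)
    have z1 := hz (b 1)
    rw [expand y] at y0 y1
    rw [expand z] at z0 z1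
    simp only [map_add_left, smul_left, h00, h11, h10, ← hq, one_mul, Module.Basis.coord_apply,
      Module.Basis.repr_self, Finsupp.single_apply] at y0 y1 z0 z1
    norm_num at y0 y1 z0 z1
    set y' := b.repr y
    set z' := b.repr z
    have hdet : (cj (y' 1) * cj (z' 0) - cj (y' 0) * cj (z' 1)) * (D : R) = 1 := by
      rw [hDR]
      linear_combination (cj (z' 0) * q + cj (z' 1) * r) * y0 + z1
        - (cj (z' 0) * p + cj (z' 1) * cj q) * y1
    have hn := congrArg nrm hdet
    rw [nrm_mul, nrm_intCast] at hn
    have h1 : nrm (1 : R) = 1 := by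
      have := nrm_intCast (R := R) 1
      simpa using this
    rw [h1] at hn
    have : D ∣ 1 := Dvd.intro_left
      (nrm (cj (y' 1) * cj (z' 0) - cj (y' 0) * cj (z' 1)) * D) (by rw [← hn]; ring)
    exact Int.isUnit_iff.1 (isUnit_of_dvd_one this)
  rcases hunit with h1 | h1
  -- For D = 1 the completed square is N(p x₀ + q x₁) - N(x₁), which vanishes when both arguments
  -- equal p.
  · refine ⟨(1 - q) • b 0 + (p : R) • b 1, fun h0 => ?_, ?_⟩
    · have := congrArg (fun v => b.repr v 1) h0
      simp at this
      exact hp0 this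
    · rw [h1] at hDR
      push_cast at hDR
      simp only [map_add, map_smul, smul_eq_mul, map_add_left, smul_left, h00, h11, h10, ← hq,
        map_sub, map_one, map_intCast]
      linear_combination (p : R) * hDR
  -- For D = -1 the form would be semidefinite, whereas it takes both signs.
  · exfalso
    obtain ⟨v, hv, hneg⟩ := H
    obtain ⟨u, hu0, hu⟩ := exists_ne_zero_of_finrank_lt (h v) (by
      rw [Module.finrank_self]; omega)
    have hu' := hneg u hu hu0
    have k1 := key v
    have k2 := key u
    rw [h1] at k1 k2
    have n1 := nrm_nonneg ((p : R) * b.repr v 0 + q * b.repr v 1)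
    have n2 := nrm_nonneg (b.repr v 1)
    have n3 := nrm_nonneg ((p : R) * b.repr u 0 + q * b.repr u 1)
    have n4 := nrm_nonneg (b.repr u 1)
    rcases lt_or_gt_of_ne hp0 with hlt | hgt
    · nlinarith
    · nlinarith

/-- Some vector has norm in the nontrivial class modulo traces (automatic if `1` is a trace). -/
def IsOdd (h : HermitianForm R V) : Prop := ∃ (v : V) (a : R), h v v = 1 + (a + cj a)

/-- Take e isotropic and f with e ⋆ f = 1. Adding multiples of e changes f ⋆ f by any trace, so once
f ⋆ f is in the class of 1 modulo traces it can be made -1. Then e + f has norm 1 and is orthogonal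
to f. -/
theorem exists_negative_unit [Module.Free R V] [Module.Finite R V]
    (H : h.Lorentzian) (P : h.Perfect 1) (O : h.IsOdd) (hrk : 2 ≤ Module.finrank R V) :
    ∃ f g, h f f = -1 ∧ h g g = 1 ∧ h f g = 0 := by
  obtain ⟨e₀, he₀, hiso₀⟩ : ∃ e, e ≠ 0 ∧ h e e = 0 := by
    rcases hrk.eq_or_lt with h2 | h3
    · exact H.exists_isotropic_of_rank_two P h2.symm
    · exact H.exists_isotropic h3
  obtain ⟨c, e, f₀, rfl, hef₀⟩ := P.exists_dual one_ne_zero he₀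
  have hiso : h e e = 0 := by
    have hc : c ≠ 0 := fun h0 => he₀ (by rw [h0, zero_smul])
    rw [map_smul, smul_left, smul_eq_mul] at hiso₀
    have := (mul_eq_zero.1 hiso₀).resolve_left hc
    exact (mul_eq_zero.1 this).resolve_left (cj_ne_zero hc)
  obtain ⟨f₁, hef₁, a₁, ha₁⟩ : ∃ f, h e f = 1 ∧ ∃ a, h f f = 1 + (a + cj a) := by
    rcases NormEuclidean.trace_parity (R := R) (h.sq f₀) with ⟨a, ha⟩ | ⟨a, ha⟩
    · rw [coe_sq] at ha
      obtain ⟨v, d, hv⟩ := O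
      set c := h e v with hc
      -- If f₀ has a trace as norm, add the projection w of an odd vector to e^⊥ along f₀: w has odd
      -- norm, and f₀ + w still pairs to 1 with e.
      set w := v - c • f₀ with hw
      have hew : h e w = 0 := by rw [hw, map_sub, map_smul, hef₀, ← hc]; simp
      obtain ⟨m, hm⟩ := exists_norm c
      refine ⟨f₀ + w, by rw [map_add, hef₀, hew, add_zero],
        a + d + m * a - c * h v f₀ + h f₀ w, ?_⟩
      have hfv : h f₀ v = cj (h v f₀) := (h.cj_apply _ _).symm
      simp only [hw, map_add_left, sub_left, smul_left, map_add, map_sub, map_smul, smul_eq_mul,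
        map_mul, hv, ha, hfv, hm, cj_cj]
      ring_nf
    · exact ⟨f₀, hef₀, a, by rw [← coe_sq, ha]⟩
  have hfe₁ : h f₁ e = 1 := by rw [← h.cj_apply, hef₁, map_one]
  set f := f₁ + (-1 - a₁) • e with hf
  have hef : h e f = 1 := by rw [hf, map_add, map_smul, hiso, hef₁]; simp
  have hff : h f f = -1 := by
    simp only [hf, map_add_left, smul_left, map_add, map_smul, smul_eq_mul, map_sub, map_neg,
      map_one, ha₁, hef₁, hfe₁, hiso]
    ring
  have hfe : h f e = 1 := by rw [← h.cj_apply, hef, map_one]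
  refine ⟨f, e + f, hff, ?_, ?_⟩
  · simp only [map_add_left, map_add, hff, hef, hfe, hiso]; ring
  · rw [map_add, hfe, hff]; ring

/-- As f ⋆ f is a unit, x ↦ x + (f ⋆ x) f projects onto f^⊥. A functional on f^⊥ is extended by zero
on f, represented, and its representative projected back. -/
theorem Perfect.restrict_ker (P : h.Perfect 1) {f : V} (hf : h f f = -1) :
    (h.restrict (LinearMap.ker (h f))).Perfect 1 := by
  refine ⟨fun _ _ => one_dvd _, fun φ => ?_⟩
  let π : V →ₗ[R] LinearMap.ker (h f) :=
    (LinearMap.id + (h f).smulRight f).codRestrict _ fun x => by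
      simp [hf]
  obtain ⟨y, hy⟩ := P.2 (φ ∘ₗ π)
  refine ⟨π y, fun x => ?_⟩
  have hx : h f x.1 = 0 := x.2
  have e1 : h.restrict _ (π y) x = h y x.1 := by
    change h (y + h f y • f) x.1 = _
    rw [map_add_left, smul_left, hx, mul_zero, add_zero]
  have e2 : π x.1 = x := by
    apply Subtype.ext
    change x.1 + h f x.1 • f = x.1
    rw [hx, zero_smul, add_zero]
  rw [e1, hy, LinearMap.comp_apply, e2]

/-- An indefinite odd unimodular lattice of signature `(1, n)` is `⟨1⟩ ⊕ ⟨-1⟩ⁿ`. -/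
theorem exists_orthogonal_basis (n : ℕ) : ∀ {V : Type u} [AddCommGroup V] [Module R V]
    [Module.Free R V] [Module.Finite R V] (h : HermitianForm R V), h.Lorentzian → h.Perfect 1 →
    h.IsOdd → Module.finrank R V = n + 1 → ∃ b : Module.Basis (Fin (n + 1)) R V, ∀ i j,
      h (b i) (b j) = if i = j then (if i = Fin.last n then 1 else -1) else 0 := by
  induction n with
  | zero =>
    intro V _ _ _ _ h H P _ hrk
    let b : Module.Basis (Fin 1) R V := Module.finBasisOfFinrankEq R V hrk
    refine ⟨b, ?_⟩
    have expand : ∀ x : V, x = b.repr x 0 • b 0 := fun x => by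
      conv_lhs => rw [← b.sum_repr x, Fin.sum_univ_one]
    obtain ⟨y, hy⟩ := P.2 (b.coord 0)
    have h1 := hy (b 0)
    rw [expand y, smul_left, ← coe_sq] at h1
    simp only [Module.Basis.coord_apply, Module.Basis.repr_self, Finsupp.single_eq_same,
      mul_one] at h1
    have h2 := congrArg nrm h1
    have h3 : nrm (1 : R) = 1 := by
      have := nrm_intCast (R := R) 1
      simpa using this
    rw [nrm_mul, nrm_intCast, h3] at h2
    have h4 : h.sq (b 0) = 1 ∨ h.sq (b 0) = -1 :=
      Int.isUnit_iff.1 (isUnit_of_dvd_one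
        (Dvd.intro_left (nrm (cj (b.repr y 0)) * h.sq (b 0)) (by rw [← h2]; ring)))
    have h5 : h.sq (b 0) = 1 := by
      refine h4.resolve_right fun h6 => ?_
      obtain ⟨v, hv, -⟩ := H
      rw [expand v, sq_smul, h6] at hv
      have := nrm_nonneg (b.repr v 0)
      omega
    intro i j
    fin_cases i
    fin_cases j
    simp [← coe_sq, h5]
  | succ n ih =>
    intro V _ _ _ _ h H P O hrk
    obtain ⟨f, g, hf, hg, hfg⟩ := exists_negative_unit H P O (by omega)
    have hgpos : 0 < h.sq g := by
      rw [h.sq_eq (n := 1) (by simpa using hg)]; exact one_pos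
    have hrk' : Module.finrank R (LinearMap.ker (h f)) = n + 1 := by
      have hsurj : LinearMap.range (h f) = ⊤ := LinearMap.range_eq_top.2 fun c =>
        ⟨(-c) • f, by rw [map_smul, hf]; simp⟩
      have := (LinearMap.ker (h f)).finrank_quotient_add_finrank
      rw [(h f).quotKerEquivRange.finrank_eq, hsurj, finrank_top, Module.finrank_self] at this
      omega
    -- The norm 1 vector g in f^⊥ keeps the complement both Lorentzian and odd. The vectors of norm
    -- -1 are put in front, so the positive one ends up last.
    obtain ⟨b, hb⟩ := ih (h.restrict (LinearMap.ker (h f)))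
      (H.restrict _ (x := g) hfg hgpos) (P.restrict_ker hf)
      ⟨⟨g, hfg⟩, 0, by simp [hg]⟩ hrk'
    have hbf : ∀ i, h f (b i).1 = 0 := fun i => (b i).2
    refine ⟨Module.Basis.mkFinCons f b (fun c x hx h0 => ?_)
      (fun z => ⟨h f z, ?_⟩), ?_⟩
    · have h1 := congrArg (h f) h0
      have hx' : h f x = 0 := hx
      simpa [hf, hx'] using h1
    · rw [LinearMap.mem_ker, map_add, map_smul, hf]; simp
    · rw [Module.Basis.coe_mkFinCons]
      intro i j
      refine Fin.cases ?_ (fun i => ?_) i <;> refine Fin.cases ?_ (fun j => ?_) j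
      · simp [hf, (Fin.last_pos).ne]
      · simp [hbf, (Fin.succ_ne_zero _).symm]
      · simp [h.apply_eq_zero_comm (hbf _), Fin.succ_ne_zero]
      · have := hb i j
        rw [restrict_apply] at this
        simp only [Fin.cons_succ, Function.comp_apply, this, Fin.succ_inj]
        simp [← Fin.succ_last, -Fin.succ_eq_last_succ, Fin.succ_inj]

theorem sum_left {ι : Type*} (s : Finset ι) (w : ι → V) (z : V) :
    h (∑ i ∈ s, w i) z = ∑ i ∈ s, h (w i) z := by
  rw [← h.cj_apply, map_sum, map_sum]
  exact Finset.sum_congr rfl fun i _ => h.cj_apply _ _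

theorem isometric_of_odd {W : Type v} [AddCommGroup W] [Module R W] [Module.Free R V]
    [Module.Finite R V] [Module.Free R W] [Module.Finite R W] {h' : HermitianForm R W}
    (H : h.Lorentzian) (P : h.Perfect 1) (O : h.IsOdd)
    (H' : h'.Lorentzian) (P' : h'.Perfect 1) (O' : h'.IsOdd)
    (hrk : Module.finrank R V = Module.finrank R W) (hpos : 0 < Module.finrank R V) :
    Isometric h h' := by
  obtain ⟨n, hn⟩ := Nat.exists_eq_succ_of_ne_zero hpos.ne'
  obtain ⟨b, hb⟩ := exists_orthogonal_basis n h H P O hn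
  obtain ⟨b', hb'⟩ := exists_orthogonal_basis n h' H' P' O' (hrk ▸ hn)
  refine ⟨b.equiv b' (Equiv.refl _), fun x y => ?_⟩
  rw [← b.sum_repr x, ← b.sum_repr y]
  simp only [map_sum, map_smul, Module.Basis.equiv_apply, Equiv.refl_apply, smul_eq_mul,
    sum_left, smul_left, hb, hb']

end HermitianForm

end Unimodular

end HermLat

/-! ### Transvections and transitivity on Lagrangians modulo α. -/

namespace HermLat

open NormEuclidean (cj)

/-- The arithmetic of the element `1 + ζ` that is used below. -/
structure IsModulus {R : Subalgebra ℤ ℂ} [NormEuclidean R] (α : R) (p : ℤ) : Prop where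
  pos : 0 < p
  mul_cj : α * cj α = p
  add_cj : α + cj α = p
  cj_assoc : ∃ u : R, u * cj u = 1 ∧ cj α = u * α
  dvd_int : ∀ n : ℤ, α ∣ (n : R) → p ∣ n
  residue : ∀ c : R, α ∣ c ∨ α ∣ c - 1 ∨ α ∣ c + 1
  -- The last equation is the condition for x ↦ x - c (r ⋆ x) r to be an isometry when r has norm n
  -- plus the trace of pa. Modulo α, such a map has coefficient -1 and a vector of norm -2.
  lift : ∀ n : ℤ, α ∣ (n : R) + 2 → ∃ a c : R, α ∣ c + 1 ∧
    c + cj c = (c * cj c) * ((n : R) + ((p : R) * a + cj ((p : R) * a)))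

variable {R : Subalgebra ℤ ℂ} [NormEuclidean R]

namespace IsModulus

variable {α : R} {p : ℤ} (hα : IsModulus α p)

include hα

theorem ne_zero_p : (p : R) ≠ 0 := by exact_mod_cast hα.pos.ne'

theorem ne_zero : α ≠ 0 := by
  rintro rfl
  have := hα.mul_cj
  rw [zero_mul] at this
  exact hα.ne_zero_p this.symm

theorem dvd_cj_iff {c : R} : α ∣ cj c ↔ α ∣ c := by
  obtain ⟨u, hu, hcu⟩ := hα.cj_assoc
  have key : ∀ c : R, α ∣ c → α ∣ cj c := by
    rintro _ ⟨d, rfl⟩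
    exact ⟨u * cj d, by rw [map_mul, hcu]; ring⟩
  exact ⟨fun h => by simpa using key _ h, key c⟩

end IsModulus

namespace HermitianForm

variable {V : Type u} [AddCommGroup V] [Module R V] {h : HermitianForm R V}

section Transvection

variable (h)

/-- The map `x ↦ x - c (r ⋆ x) r`. -/
def transvectionMap (c : R) (r : V) : V →ₗ[R] V := LinearMap.id - (c • h r).smulRight r

omit [NormEuclidean R] in
theorem transvectionMap_apply (c : R) (r x : V) :
    h.transvectionMap c r x = x - (c * h r x) • r := rfl

variable {h}

omit [NormEuclidean R] in
theorem transvectionMap_comp {c c' : R} {r : V} (H : c + c' = c * c' * h r r) (x : V) :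
    h.transvectionMap c r (h.transvectionMap c' r x) = x := by
  rw [transvectionMap_apply, transvectionMap_apply, map_sub, map_smul, smul_eq_mul, sub_sub,
    ← add_smul]
  have : c' * h r x + c * (h r x - c' * h r x * h r r) = 0 := by
    linear_combination h r x * H
  rw [this, zero_smul, sub_zero]

theorem transvectionMap_isometry {c : R} {r : V} (H : c + cj c = c * cj c * h r r) (x y : V) :
    h (h.transvectionMap c r x) (h.transvectionMap c r y) = h x y := by
  have hxr : h x r = cj (h r x) := (h.cj_apply _ _).symm
  simp only [transvectionMap_apply, map_sub, map_smul, smul_eq_mul, sub_left, smul_left, map_mul,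
    hxr]
  linear_combination (-(cj (h r x) * h r y)) * H

/-- The transvection or reflection `x ↦ x - c (r ⋆ x) r`, as an element of the unitary group. -/
def transvection (c : R) (r : V) (H : c + cj c = c * cj c * h r r) : h.isometryGroup :=
  ⟨LinearEquiv.ofLinearMap (h.transvectionMap c r) (h.transvectionMap (cj c) r)
    (LinearMap.ext fun x => transvectionMap_comp H x)
    (LinearMap.ext fun x => transvectionMap_comp
      (by rw [add_comm, H, mul_comm (cj c)]) x),
   transvectionMap_isometry H⟩

theorem transvection_apply (c : R) (r : V) (H : c + cj c = c * cj c * h r r) (x : V) :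
    (transvection c r H).1 x = x - (c * h r x) • r := rfl

end Transvection

section Lagrangian

variable (h)

/-- `P / αV` is its own orthogonal complement in `V / αV`. -/
structure IsLagrangian (α : R) (P : Submodule R V) : Prop where
  smul_mem : ∀ x, α • x ∈ P
  dvd : ∀ x ∈ P, ∀ y ∈ P, α ∣ h x y
  mem : ∀ y, (∀ x ∈ P, α ∣ h y x) → y ∈ P

variable {h}

omit [NormEuclidean R] in
theorem IsLagrangian.map {W : Type v} [AddCommGroup W] [Module R W] {h' : HermitianForm R W}
    {α : R} {P : Submodule R V} (H : h.IsLagrangian α P) (g : V ≃ₗ[R] W)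
    (hg : ∀ x y, h' (g x) (g y) = h x y) : h'.IsLagrangian α (P.map (g : V →ₗ[R] W)) := by
  refine ⟨fun x => ⟨α • g.symm x, H.smul_mem _, by simp⟩, ?_, fun y hy => ?_⟩
  · rintro _ ⟨x, hx, rfl⟩ _ ⟨y, hy, rfl⟩
    exact (hg x y).symm ▸ H.dvd x hx y hy
  · refine ⟨g.symm y, H.mem _ fun x hx => ?_, by simp⟩
    have := hy (g x) ⟨x, hx, rfl⟩
    rwa [← g.apply_symm_apply y, hg] at this

theorem dvd_apply_add_smul {α : R} {p : ℤ} (hα : IsModulus α p) (x y z : V) :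
    α ∣ h (x + α • y) z ↔ α ∣ h x z := by
  rw [map_add_left, smul_left]
  exact dvd_add_left ((hα.dvd_cj_iff.2 dvd_rfl).mul_right _)

theorem dvd_sq_add_smul {α : R} {p : ℤ} (hα : IsModulus α p) (x y : V) :
    α ∣ h (x + α • y) (x + α • y) - h x x := by
  have e : h (x + α • y) (x + α • y) - h x x = α * h (x + α • y) y + cj α * h y x := by
    simp only [map_add_left, smul_left, map_add, map_smul, smul_eq_mul]
    ring
  rw [e]
  exact dvd_add (dvd_mul_right _ _) ((hα.dvd_cj_iff.2 dvd_rfl).mul_right _)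

/-- A vector of norm `-2` modulo `α` can be changed modulo `α` so as to define a transvection. -/
theorem exists_transvection_lift {α : R} {p : ℤ} (hα : IsModulus α p) {e f : V} (he : h e e = 0)
    (hef : h e f = 1) (r : V) (hr : α ∣ h r r + 2) : ∃ (y : V) (c : R), α ∣ c + 1 ∧
      c + cj c = c * cj c * h (r + α • y) (r + α • y) := by
  -- Moving r by a multiple of αf makes e ⋆ r₁ equal to α, 1 or -1, according to its residue. Adding
  -- αb e to r₁ then changes its norm by the trace of αb (r₁ ⋆ e), and a suitable b makes this the
  -- trace of pa for any prescribed a, as `IsModulus.lift` requires.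
  obtain ⟨y₁, hy₁⟩ : ∃ y, ∀ a, ∃ b, α * b * h (r + α • y) e = p * a := by
    have swap : ∀ x, h x e = cj (h e x) := fun x => (h.cj_apply _ _).symm
    rcases hα.residue (h e r) with ⟨d, hd⟩ | ⟨d, hd⟩ | ⟨d, hd⟩
    · refine ⟨(1 - d) • f, fun a => ⟨a, ?_⟩⟩
      have : h e (r + α • (1 - d) • f) = α := by
        simp only [map_add, map_smul, smul_eq_mul, hef, hd]; ring
      rw [swap, this]
      linear_combination a * hα.mul_cj
    · refine ⟨(-d) • f, fun a => ⟨cj α * a, ?_⟩⟩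
      have : h e (r + α • (-d) • f) = 1 := by
        simp only [map_add, map_smul, smul_eq_mul, hef]; linear_combination hd
      rw [swap, this, map_one]
      linear_combination a * hα.mul_cj
    · refine ⟨(-d) • f, fun a => ⟨-(cj α * a), ?_⟩⟩
      have : h e (r + α • (-d) • f) = -1 := by
        simp only [map_add, map_smul, smul_eq_mul, hef]; linear_combination hd
      rw [swap, this, map_neg, map_one]
      linear_combination a * hα.mul_cj
  set r₁ := r + α • y₁ with hr₁
  have hr₁2 : α ∣ (h.sq r₁ + 2 : R) := by
    rw [coe_sq]
    have := dvd_add (dvd_sq_add_smul (h := h) hα r y₁) hr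
    rwa [show h (r + α • y₁) (r + α • y₁) - h r r + (h r r + 2) = h r₁ r₁ + 2 by
      rw [hr₁]; ring] at this
  obtain ⟨a, c, hc, hcc⟩ := hα.lift _ hr₁2
  obtain ⟨b, hb⟩ := hy₁ a
  refine ⟨y₁ + b • e, c, hc, ?_⟩
  have e1 : r + α • (y₁ + b • e) = r₁ + (α * b) • e := by rw [hr₁]; module
  have e2 : h e r₁ = cj (h r₁ e) := (h.cj_apply _ _).symm
  rw [e1, hcc, coe_sq, ← hb, map_mul _ (α * b)]
  simp only [map_add_left, smul_left, map_add, map_smul, smul_eq_mul, he, e2]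
  ring

/-- The unitary group acts transitively on Lagrangians. -/
theorem exists_isometry_map_eq [Module.Finite R V] {α : R} {p : ℤ} (hα : IsModulus α p)
    {e f : V} (he : h e e = 0) (hef : h e f = 1) {P Q : Submodule R V}
    (hP : h.IsLagrangian α P) (hQ : h.IsLagrangian α Q) :
    ∃ g ∈ h.isometryGroup, P.map (g : V →ₗ[R] V) = Q := by
  -- Choose g with gP ∩ Q maximal, by the ascending chain condition. If x ∈ gP lies outside Q, some
  -- y ∈ Q has x ⋆ y ≡ 1, and r ≡ x - y has norm ≡ -2 modulo α. The lifted transvection along r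
  -- fixes gP ∩ Q modulo α and sends x to y modulo α, so it enlarges the intersection by y ∉ gP.
  obtain ⟨D, ⟨g, hg, rfl⟩, hmax⟩ := (wellFounded_gt (α := Submodule R V)).has_min
    {D | ∃ g ∈ h.isometryGroup, D = P.map (g : V →ₗ[R] V) ⊓ Q} ⟨_, 1, one_mem _, rfl⟩
  refine ⟨g, hg, ?_⟩
  have hP' := hP.map g hg
  set P' := P.map (g : V →ₗ[R] V) with hP'def
  suffices hle : P' ≤ Q from
    le_antisymm hle fun y hy => hP'.mem y fun x hx => hQ.dvd y hy x (hle hx)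
  intro x hx
  by_contra hxQ
  obtain ⟨y, hy, hxy⟩ : ∃ y ∈ Q, α ∣ h x y - 1 := by
    by_contra hc
    push Not at hc
    refine hxQ (hQ.mem x fun y hy => ?_)
    rcases hα.residue (h x y) with h1 | h1 | h1
    · exact h1
    · exact absurd h1 (hc y hy)
    · refine absurd ?_ (hc (-y) (Q.neg_mem hy))
      rw [map_neg, ← neg_add', dvd_neg]
      exact h1
  have hyx : α ∣ h y x - 1 := by
    rw [← hα.dvd_cj_iff, map_sub, h.cj_apply, map_one]
    exact hxy
  have hxx := hP'.dvd x hx x hx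
  have hyy := hQ.dvd y hy y hy
  -- When α is a unit (k = 3) every Lagrangian is the whole module.
  by_cases hunit : α ∣ 1
  · exact hxQ (hQ.mem x fun z _ => hunit.trans (one_dvd _))
  have hyP' : y ∉ P' := fun hyP => hunit (by
    have := dvd_sub (hP'.dvd x hx y hyP) hxy
    rwa [sub_sub_cancel] at this)
  obtain ⟨z, c, hc, hcc⟩ := exists_transvection_lift (h := h) hα he hef (x - y) (by
    have e1 : h (x - y) (x - y) + 2 = h x x + h y y - (h x y - 1) - (h y x - 1) := by
      simp only [sub_left, map_sub]; ring
    rw [e1]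
    exact dvd_sub (dvd_sub (dvd_add hxx hyy) hxy) hyx)
  set r := x - y + α • z with hr
  let T := transvection c r hcc
  have hTP := hP'.map T.1 T.2
  refine hmax _ ⟨T.1 * g, mul_mem T.2 hg, rfl⟩ ?_
  have hmap : P.map ((T.1 * g : V ≃ₗ[R] V) : V →ₗ[R] V) =
      P'.map (T.1 : V →ₗ[R] V) := by
    rw [hP'def, ← Submodule.map_comp]
    rfl
  rw [hmap]
  refine lt_of_le_of_ne (fun d hd => ⟨?_, hd.2⟩) fun heq => ?_
  · have hrd : α ∣ h r d := by
      rw [hr, dvd_apply_add_smul hα, sub_left]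
      exact dvd_sub (hP'.dvd x hx d hd.1) (hQ.dvd y hy d hd.2)
    obtain ⟨m, hm⟩ := hrd
    -- T moves d only by a multiple of α, and a Lagrangian contains αV.
    have e1 : d = T.1 d + α • ((c * m) • r) := by
      rw [transvection_apply, hm]
      module
    rw [e1]
    exact add_mem ⟨d, hd.1, rfl⟩ (hTP.smul_mem _)
  · have hrx : α ∣ h r x + 1 := by
      rw [← hα.dvd_cj_iff, map_add, map_one, h.cj_apply, hr, map_add, map_sub, map_smul,
        smul_eq_mul]
      have e1 : h x x - h x y + α * h x z + 1 = h x x - (h x y - 1) + α * h x z := by ring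
      rw [e1]
      exact dvd_add (dvd_sub hxx hxy) (dvd_mul_right _ _)
    obtain ⟨m, hm⟩ := hrx
    obtain ⟨n, hn⟩ := hc
    -- With c ≡ -1 and r ⋆ x ≡ -1, T x ≡ x - r ≡ y modulo α.
    have e1 : y = T.1 x + α • ((n * h r x - m) • r + z) := by
      rw [transvection_apply]
      have e2 : c = α * n - 1 := by rw [← hn]; ring
      have e3 : (c * h r x) • r = (α * n * h r x - α * m + 1) • r := by
        congr 1
        rw [e2]
        linear_combination -hm
      rw [e3, hr]
      module
    have : y ∈ P'.map (T.1 : V →ₗ[R] V) ⊓ Q := by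
      refine ⟨?_, hy⟩
      rw [e1]
      exact add_mem ⟨x, hx, rfl⟩ (hTP.smul_mem _)
    rw [← heq] at this
    exact hyP' this.1

end Lagrangian

end HermitianForm

end HermLat

/-! ### From modular lattices to Lagrangians in unimodular ones. -/

namespace HermLat

open NormEuclidean (cj)

variable {R : Subalgebra ℤ ℂ} [NormEuclidean R]

namespace HermitianForm

variable {V : Type u} [AddCommGroup V] [Module R V] {h : HermitianForm R V}

section Divide

variable (h)

theorem exists_divide {p : ℤ} (hp : p ≠ 0) (H : ∀ x y, (p : R) ∣ h x y) :
    ∃ k : HermitianForm R V, ∀ x y, h x y = p * k x y := by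
  have hp' : (p : R) ≠ 0 := by exact_mod_cast hp
  choose c hc using H
  refine ⟨{
    toFun := fun x =>
      { toFun := c x
        map_add' := fun y z => mul_left_cancel₀ hp' (by
          rw [← hc, mul_add, ← hc, ← hc, map_add])
        map_smul' := fun a y => mul_left_cancel₀ hp' (by
          rw [← hc, map_smul, hc, smul_eq_mul, smul_eq_mul, RingHom.id_apply]; ring) }
    conj_symm := fun x y => ?_ }, hc⟩
  change conj (c y x : ℂ) = (c x y : ℂ)
  rw [← NormEuclidean.coe_cj]
  congr 1
  refine mul_left_cancel₀ hp' ?_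
  rw [← hc, ← h.cj_apply, hc, map_mul, map_intCast]

theorem dvd_sup_span {p : ℤ} {X : Submodule R V} {y : V}
    (hX : ∀ x ∈ X, ∀ x' ∈ X, (p : R) ∣ h x x') (hyX : ∀ x ∈ X, (p : R) ∣ h y x)
    (hy : (p : R) ∣ h y y) :
    ∀ x ∈ X ⊔ R ∙ y, ∀ x' ∈ X ⊔ R ∙ y, (p : R) ∣ h x x' := by
  have hXy : ∀ x ∈ X, (p : R) ∣ h x y := fun x hx => by
    obtain ⟨c, hc⟩ := hyX x hx
    exact ⟨cj c, by rw [← h.cj_apply, hc, map_mul, map_intCast]⟩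
  intro x hx x' hx'
  obtain ⟨v, hv, _, hw, rfl⟩ := Submodule.mem_sup.1 hx
  obtain ⟨a, rfl⟩ := Submodule.mem_span_singleton.1 hw
  obtain ⟨v', hv', _, hw', rfl⟩ := Submodule.mem_sup.1 hx'
  obtain ⟨a', rfl⟩ := Submodule.mem_span_singleton.1 hw'
  simp only [map_add_left, smul_left, map_add, map_smul, smul_eq_mul]
  exact dvd_add (dvd_add (hX v hv v' hv') ((hyX v' hv').mul_left _))
    ((dvd_add (hXy v hv) (hy.mul_left _)).mul_left _)

end Divide

variable {α : R} {p : ℤ}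

theorem Lorentzian.exists_ne_zero (H : h.Lorentzian) : ∃ e : V, e ≠ 0 := by
  obtain ⟨v, hv, -⟩ := H
  exact ⟨v, fun h0 => by rw [h0, sq_zero] at hv; exact lt_irrefl _ hv⟩

theorem Perfect.dvd_sq (P : h.Perfect α) (hα : IsModulus α p) (x : V) : p ∣ h.sq x :=
  hα.dvd_int _ (by rw [coe_sq]; exact P.1 x x)

/-- Take l ⋆ m = α. If l and m both have norm p times a trace, then l + m has norm p times 1 plus a
trace, because the cross terms give α + ᾱ = p. -/
theorem Perfect.exists_odd [Module.Free R V] (P : h.Perfect α) (hα : IsModulus α p)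
    {e : V} (he : e ≠ 0) : ∃ (x : V) (a : R), h x x = p * (1 + (a + cj a)) := by
  obtain ⟨-, l, m, -, hlm⟩ := P.exists_dual hα.ne_zero he
  obtain ⟨n, hn⟩ := P.dvd_sq hα l
  obtain ⟨n', hn'⟩ := P.dvd_sq hα m
  have hl : h l l = p * n := by rw [← coe_sq, hn]; push_cast; rfl
  have hm : h m m = p * n' := by rw [← coe_sq, hn']; push_cast; rfl
  rcases NormEuclidean.trace_parity (R := R) n with ⟨a, ha⟩ | ⟨a, ha⟩
  swap
  · exact ⟨l, a, by rw [hl, ha]⟩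
  rcases NormEuclidean.trace_parity (R := R) n' with ⟨a', ha'⟩ | ⟨a', ha'⟩
  swap
  · exact ⟨m, a', by rw [hm, ha']⟩
  have hml : h m l = cj α := by rw [← h.cj_apply, hlm]
  refine ⟨l + m, a + a', ?_⟩
  simp only [map_add_left, map_add, hl, hm, hlm, hml, ha, ha']
  linear_combination hα.add_cj

/-- A modular Lorentzian lattice is isometric to a Lagrangian in an odd unimodular one. -/
theorem Perfect.exists_overlattice [Module.Free R V] [Module.Finite R V] (P : h.Perfect α)
    (hα : IsModulus α p) (H : h.Lorentzian) :
    ∃ (X : Submodule R V) (k : HermitianForm R X) (j : V →ₗ[R] X), Function.Injective j ∧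
      (∀ x y, k (j x) (j y) = h x y) ∧ k.Perfect 1 ∧ k.Lorentzian ∧ k.IsOdd ∧
      k.IsLagrangian α (LinearMap.range j) ∧ Module.finrank R X = Module.finrank R V := by
  have hα0 := hα.ne_zero
  have hp0 := hα.ne_zero_p
  obtain ⟨e, he⟩ := H.exists_ne_zero
  obtain ⟨x₀, a₀, hx₀⟩ := P.exists_odd hα he
  obtain ⟨u, hu, hcu⟩ := hα.cj_assoc
  let αV : Submodule R V := LinearMap.range (LinearMap.lsmul R V α)
  have hαV : ∀ x ∈ αV, ∀ y ∈ αV, (p : R) ∣ h x y := by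
    rintro _ ⟨x, rfl⟩ _ ⟨y, rfl⟩
    refine ⟨h x y, ?_⟩
    simp only [LinearMap.lsmul_apply, map_smul, smul_left, smul_eq_mul]
    linear_combination h x y * hα.mul_cj
  have hαx : ∀ y, ∀ x ∈ αV, (p : R) ∣ h y x := by
    rintro y _ ⟨x, rfl⟩
    obtain ⟨c, hc⟩ := P.1 y x
    refine ⟨cj u * c, ?_⟩
    simp only [LinearMap.lsmul_apply, map_smul, smul_eq_mul, hc]
    rw [← hα.mul_cj, hcu]
    linear_combination (-α * α * c) * hu
  -- X is maximal among the submodules on which p divides the form. A vector y whose products with X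
  -- are divisible by p can be adjoined, since p divides y ⋆ y by modularity; so y is already in X,
  -- which yields unimodularity. Including x₀ makes the divided form odd.
  obtain ⟨X, ⟨hX₀, hXp⟩, hmax⟩ := (wellFounded_gt (α := Submodule R V)).has_min
    {X | αV ⊔ R ∙ x₀ ≤ X ∧ ∀ x ∈ X, ∀ y ∈ X, (p : R) ∣ h x y}
    ⟨_, le_rfl, h.dvd_sup_span hαV (hαx x₀) (hx₀ ▸ dvd_mul_right _ _)⟩
  have hmem : ∀ y, (∀ x ∈ X, (p : R) ∣ h y x) → y ∈ X := by
    intro y hy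
    have hyy : (p : R) ∣ h y y := by
      rw [← coe_sq]
      exact_mod_cast Int.cast_dvd_cast (α := R) _ _ (P.dvd_sq hα y)
    by_contra hyX
    refine hmax (X ⊔ R ∙ y) ⟨hX₀.trans le_sup_left, h.dvd_sup_span hXp hy hyy⟩
      (lt_of_le_of_ne le_sup_left fun heq => hyX ?_)
    rw [heq]
    exact Submodule.mem_sup_right (Submodule.mem_span_singleton_self y)
  have hαX : ∀ x, α • x ∈ X := fun x => hX₀ (Submodule.mem_sup_left ⟨x, rfl⟩)
  have hx₀X : x₀ ∈ X := hX₀ (Submodule.mem_sup_right (Submodule.mem_span_singleton_self _))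
  obtain ⟨k, hk⟩ := exists_divide (h.restrict X) hα.pos.ne' fun x y => hXp _ x.2 _ y.2
  simp only [restrict_apply] at hk
  have hksq : ∀ x : X, h.sq x.1 = p * k.sq x := fun x => by
    rw [← intCast_inj' (R := R)]
    push_cast
    rw [coe_sq, coe_sq, hk]
  let j : V →ₗ[R] X := (LinearMap.lsmul R V α).codRestrict X hαX
  have hj : ∀ x, (j x).1 = α • x := fun x => rfl
  have hjinj : Function.Injective j := (injective_iff_map_eq_zero j).2 fun x hx =>
    (smul_eq_zero.1 (congrArg Subtype.val hx : α • x = 0)).resolve_left hα0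
  refine ⟨X, k, j, hjinj, fun x y => ?_, ⟨fun _ _ => one_dvd _, fun φ => ?_⟩, ?_, ?_, ?_, ?_⟩
  · refine mul_left_cancel₀ hp0 ?_
    rw [← hk, hj, hj, map_smul, smul_left, smul_eq_mul]
    linear_combination h x y * hα.mul_cj
  -- The unit u turns one factor α into ᾱ: for x in X, y ⋆ x = α u φ(αx) = αᾱ φ(x) = p φ(x).
  · obtain ⟨y, hy⟩ := P.2 (u • φ ∘ₗ j)
    have hyX : ∀ x : X, h y x.1 = p * φ x := by
      intro x
      have e1 : j x.1 = α • x := Subtype.ext rfl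
      rw [hy, LinearMap.smul_apply, LinearMap.comp_apply, e1, map_smul, smul_eq_mul, smul_eq_mul,
        ← hα.mul_cj, hcu]
      ring
    refine ⟨⟨y, hmem y fun x hx => ⟨_, hyX ⟨x, hx⟩⟩⟩, fun x => mul_left_cancel₀ hp0 ?_⟩
    rw [← hk, hyX, one_mul]
  · obtain ⟨v, hv, -⟩ := id H
    have hv' : 0 < h.sq (α • v) := by
      rw [sq_smul]
      exact mul_pos (nrm_pos hα0) hv
    have hpp := hα.pos
    refine ⟨j v, ?_, fun y hy hne => ?_⟩
    · have := hksq (j v)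
      rw [hj] at this
      rw [this] at hv'
      exact (mul_pos_iff_of_pos_left hpp).1 hv'
    · have h1 : h (α • v) y.1 = 0 := by rw [← hj, hk, hy, mul_zero]
      have h2 := H.sq_neg hv' h1 fun h0 => hne (Subtype.ext h0)
      rw [hksq] at h2
      by_contra hc
      push Not at hc
      exact absurd (mul_nonneg hpp.le hc) (not_le.2 h2)
  · exact ⟨⟨x₀, hx₀X⟩, a₀, mul_left_cancel₀ hp0 (by rw [← hk, hx₀])⟩
  · refine ⟨fun x => ⟨x.1, Subtype.ext rfl⟩, ?_, fun y hy => ?_⟩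
    · rintro _ ⟨x, rfl⟩ _ ⟨y, rfl⟩
      have : k (j x) (j y) = h x y := by
        refine mul_left_cancel₀ hp0 ?_
        rw [← hk, hj, hj, map_smul, smul_left, smul_eq_mul]
        linear_combination h x y * hα.mul_cj
      rw [this]
      exact P.1 x y
    · have hdiv : ∀ v, ∃ c, h y.1 v = p * c := fun v => by
        obtain ⟨c, hc⟩ := hy (j v) ⟨v, rfl⟩
        refine ⟨c, mul_left_cancel₀ hα0 ?_⟩
        have := hk y (j v)
        rw [hj, map_smul, smul_eq_mul, hc] at this
        rw [this]
        ring
      choose c hc using hdiv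
      let φ : V →ₗ[R] R :=
        { toFun := c
          map_add' := fun y z => mul_left_cancel₀ hp0 (by
            rw [← hc, mul_add, ← hc, ← hc, map_add])
          map_smul' := fun a y => mul_left_cancel₀ hp0 (by
            rw [← hc, map_smul, hc, smul_eq_mul, smul_eq_mul, RingHom.id_apply]; ring) }
      -- Here y ⋆ v = p c(v) for all v in V, and y' represents αc; hence αy' and y define the same
      -- functional.
      obtain ⟨y', hy'⟩ := P.2 φ
      refine ⟨y', Subtype.ext ?_⟩
      rw [hj, ← sub_eq_zero]
      refine P.eq_zero hα0 fun x => ?_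
      rw [sub_left, smul_left, hy', hc]
      change cj α * (α * c x) - _ = 0
      linear_combination c x * hα.mul_cj
  · exact le_antisymm (LinearMap.finrank_le_finrank_of_injective X.injective_subtype)
      (LinearMap.finrank_le_finrank_of_injective hjinj)

/-- Indefinite modular lattices of signature `(1, s)` are determined by their rank. -/
theorem isometric_of_finrank_eq {W : Type v} [AddCommGroup W] [Module R W] [Module.Free R V]
    [Module.Finite R V] [Module.Free R W] [Module.Finite R W] {h' : HermitianForm R W}
    (hα : IsModulus α p) (H : h.Lorentzian) (P : h.Perfect α) (H' : h'.Lorentzian)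
    (P' : h'.Perfect α) (hrk : Module.finrank R V = Module.finrank R W)
    (h2 : 2 ≤ Module.finrank R V) : Isometric h h' := by
  obtain ⟨X, k, j, hj, hjk, kP, kH, kO, kL, kr⟩ := P.exists_overlattice hα H
  obtain ⟨X', k', j', hj', hjk', kP', kH', kO', kL', kr'⟩ := P'.exists_overlattice hα H'
  obtain ⟨φ, hφ⟩ := isometric_of_odd kH kP kO kH' kP' kO' (by rw [kr, kr', hrk]) (by omega)
  -- From norms -1 and 1, f + g is isotropic and pairs to 1 with g: the hyperbolic pair used by the
  -- transitivity result.
  obtain ⟨f, g, hf, hg, hfg⟩ := exists_negative_unit kH' kP' kO' (by omega)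
  have hgf := k'.apply_eq_zero_comm hfg
  obtain ⟨γ, hγ, hmap⟩ := exists_isometry_map_eq (e := f + g) (f := g) hα
    (by simp [map_add_left, hf, hg, hfg, hgf]) (by simp [map_add_left, hg, hfg])
    (kL.map φ hφ) kL'
  let J : V →ₗ[R] X' := (γ : X' →ₗ[R] X') ∘ₗ (φ : X →ₗ[R] X') ∘ₗ j
  have hJ : Function.Injective J := γ.injective.comp (φ.injective.comp hj)
  have hJr : LinearMap.range J = LinearMap.range j' := by
    rw [← hmap, LinearMap.range_comp, LinearMap.range_comp]
  let E : V ≃ₗ[R] W := LinearEquiv.ofInjective J hJ ≪≫ₗ LinearEquiv.ofEq _ _ hJr ≪≫ₗ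
    (LinearEquiv.ofInjective j' hj').symm
  have hE : ∀ x, j' (E x) = J x := fun x => by
    have := (LinearEquiv.ofInjective j' hj').apply_symm_apply
      (LinearEquiv.ofEq _ _ hJr (LinearEquiv.ofInjective J hJ x))
    exact congrArg Subtype.val this
  refine ⟨E, fun x y => ?_⟩
  rw [← hjk', hE, hE, ← hjk]
  exact (hγ _ _).trans (hφ _ _)

end HermitianForm

end HermLat

/-! ### Hyperbolic planes and the quotient e^⊥/e. -/

namespace HermLat

open NormEuclidean (cj)

variable {R : Subalgebra ℤ ℂ} [NormEuclidean R]

namespace HermitianForm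

variable {V : Type u} [AddCommGroup V] [Module R V] {h : HermitianForm R V}
  {W : Type v} [AddCommGroup W] [Module R W] {h' : HermitianForm R W}

section Transport

omit [NormEuclidean R] in
theorem IsNegDef.of_isometric (H : h.IsNegDef) (I : Isometric h h') : h'.IsNegDef := by
  obtain ⟨f, hf⟩ := I
  intro x hx
  rw [← f.apply_symm_apply x, hf]
  exact H _ fun h0 => hx (f.symm.map_eq_zero_iff.1 h0)

omit [NormEuclidean R] in
theorem Perfect.of_isometric {α : R} (H : h.Perfect α) (I : Isometric h h') : h'.Perfect α := by
  obtain ⟨f, hf⟩ := I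
  refine ⟨fun x y => ?_, fun φ => ?_⟩
  · rw [← f.apply_symm_apply x, ← f.apply_symm_apply y, hf]
    exact H.1 _ _
  · obtain ⟨y, hy⟩ := H.2 (φ ∘ₗ (f : V →ₗ[R] W))
    refine ⟨f y, fun x => ?_⟩
    rw [← f.apply_symm_apply x, hf, hy]
    simp

end Transport

end HermitianForm

omit [NormEuclidean R] in
theorem Isometric.symm {V : Type u} [AddCommGroup V] [Module R V] {h : HermitianForm R V}
    {W : Type v} [AddCommGroup W] [Module R W] {h' : HermitianForm R W} (H : Isometric h h') :
    Isometric h' h := by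
  obtain ⟨f, hf⟩ := H
  exact ⟨f.symm, fun x y => by rw [← hf, f.apply_symm_apply, f.apply_symm_apply]⟩

omit [NormEuclidean R] in
theorem Isometric.trans {V : Type u} [AddCommGroup V] [Module R V] {h : HermitianForm R V}
    {W : Type v} [AddCommGroup W] [Module R W] {h' : HermitianForm R W}
    {U : Type w} [AddCommGroup U] [Module R U] {h'' : HermitianForm R U} (H : Isometric h h')
    (H' : Isometric h' h'') : Isometric h h'' := by
  obtain ⟨f, hf⟩ := H
  obtain ⟨g, hg⟩ := H'
  exact ⟨f.trans g, fun x y => by rw [LinearEquiv.trans_apply, LinearEquiv.trans_apply, hg, hf]⟩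

namespace HermitianForm

section Hyperbolic

variable {V : Type u} [AddCommGroup V] [Module R V] {h : HermitianForm R V}
  {L : Type v} [AddCommGroup L] [Module R L]

/-- The orthogonal sum of `L` with the hyperbolic plane with basis `e, f`, `e ⋆ f = α`. -/
def hypSum (α : R) (l : HermitianForm R L) : HermitianForm R (R × R × L) where
  toFun x := (cj x.1 * α) • (LinearMap.fst R R L ∘ₗ LinearMap.snd R R (R × L)) +
    (cj x.2.1 * cj α) • LinearMap.fst R R (R × L) +
    l x.2.2 ∘ₗ LinearMap.snd R R L ∘ₗ LinearMap.snd R R (R × L)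
  conj_symm x y := by
    rw [← NormEuclidean.coe_cj]
    congr 1
    simp only [LinearMap.add_apply, LinearMap.smul_apply, LinearMap.comp_apply,
      LinearMap.fst_apply, LinearMap.snd_apply, smul_eq_mul, map_add, map_mul, cj_cj, l.cj_apply]
    ring

theorem hypSum_apply (α : R) (l : HermitianForm R L) (x y : R × R × L) :
    hypSum α l x y = cj x.1 * α * y.2.1 + cj x.2.1 * cj α * y.1 + l x.2.2 y.2.2 := by
  simp [hypSum]

theorem hypSum_congr (α : R) {l : HermitianForm R L} {M : Type w} [AddCommGroup M] [Module R M]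
    {m : HermitianForm R M} (H : Isometric l m) : ∃ f : (R × R × L) ≃ₗ[R] (R × R × M),
      (∀ x y, hypSum α m (f x) (f y) = hypSum α l x y) ∧ f (1, 0, 0) = (1, 0, 0) := by
  obtain ⟨g, hg⟩ := H
  refine ⟨(LinearEquiv.refl R R).prodCongr ((LinearEquiv.refl R R).prodCongr g),
    fun x y => ?_, ?_⟩
  · simp [hypSum_apply, hg]
  · simp

theorem hypSum_perfect {α : R} {p : ℤ} (hα : IsModulus α p) {l : HermitianForm R L}
    (hl : l.Perfect α) : (hypSum α l).Perfect α := by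
  obtain ⟨u, hu, hcu⟩ := hα.cj_assoc
  refine ⟨fun x y => ?_, fun φ => ?_⟩
  · rw [hypSum_apply]
    refine dvd_add (dvd_add ⟨cj x.1 * y.2.1, by ring⟩ ⟨cj x.2.1 * u * y.1, by rw [hcu]; ring⟩)
      (hl.1 _ _)
  · obtain ⟨m, hm⟩ := hl.2 (φ ∘ₗ LinearMap.inr R R (R × L) ∘ₗ LinearMap.inr R R L)
    -- The plane pairs e with f, so the two values of φ are exchanged; u compensates for f ⋆ e being
    -- ᾱ.
    refine ⟨(cj (φ (0, 1, 0)), u * cj (φ (1, 0, 0)), m), fun x => ?_⟩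
    have hx : x = x.1 • ((1, 0, 0) : R × R × L) + x.2.1 • ((0, 1, 0) : R × R × L) +
        (0, 0, x.2.2) := by
      ext <;> simp
    have hφ : φ x = x.1 * φ (1, 0, 0) + x.2.1 * φ (0, 1, 0) + φ (0, 0, x.2.2) := by
      conv_lhs => rw [hx]
      simp only [map_add, map_smul, smul_eq_mul]
    have hm' := hm x.2.2
    simp only [LinearMap.comp_apply, LinearMap.inr_apply] at hm'
    rw [hypSum_apply, hφ, hm']
    simp only [map_mul, cj_cj, hcu]
    linear_combination (φ (1, 0, 0) * α * x.1) * hu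

theorem hypSum_lorentzian {α : R} {p : ℤ} (hα : IsModulus α p) {l : HermitianForm R L}
    (hl : l.IsNegDef) : (hypSum α l).Lorentzian := by
  have hp := hα.pos
  rw [isNegDef_iff] at hl
  -- The vector e + ᾱf has norm 2αᾱ = 2p; its complement is spanned by e - ᾱf, of norm -2p, and L.
  refine ⟨(1, cj α, 0), ?_, fun y hy hne => ?_⟩
  · rw [sq_eq (n := 2 * p)]
    · omega
    · rw [hypSum_apply]
      push_cast
      simp only [cj_cj, map_one, map_zero]
      linear_combination 2 * hα.mul_cj
  · have e1 : α * (y.2.1 + cj α * y.1) = 0 := by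
      rw [hypSum_apply] at hy
      simp only [cj_cj, map_one, zero_left, add_zero, one_mul] at hy
      linear_combination hy
    have e2 : y.2.1 = -(cj α * y.1) :=
      eq_neg_of_add_eq_zero_left ((mul_eq_zero.1 e1).resolve_left hα.ne_zero)
    have e3 : (hypSum α l).sq y = -(2 * p * nrm y.1) + l.sq y.2.2 := by
      refine sq_eq _ ?_
      rw [hypSum_apply, e2]
      push_cast
      rw [coe_nrm, coe_sq, ← hα.mul_cj]
      simp only [map_neg, map_mul, cj_cj]
      ring
    rw [e3]
    by_cases h1 : y.1 = 0
    · have h2 : y.2.2 ≠ 0 := fun h0 => hne (by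
        ext1
        · exact h1
        · ext1
          · rw [e2, h1, mul_zero, neg_zero]; rfl
          · exact h0)
      rw [h1, nrm_zero]
      have := hl _ h2
      omega
    · have h3 := mul_pos hp (nrm_pos h1)
      have h4 : l.sq y.2.2 ≤ 0 := by
        by_cases h0 : y.2.2 = 0
        · rw [h0, sq_zero]
        · exact (hl _ h0).le
      nlinarith

omit [NormEuclidean R] in
theorem primitive_hypSum : IsPrimitive (R := R) ((1, 0, 0) : R × R × L) := by
  intro a x hx
  have : 1 = a * x.1 := congrArg Prod.fst hx
  exact IsUnit.of_mul_eq_one _ this.symm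

/-- A primitive isotropic vector of a modular Lorentzian lattice splits off a hyperbolic plane. -/
theorem Perfect.exists_hypSum [Module.Free R V] [Module.Finite R V] {α : R} {p : ℤ}
    (hα : IsModulus α p) (P : h.Perfect α) (H : h.Lorentzian) {e : V}
    (hprim : IsPrimitive (R := R) e) (he : h e e = 0) :
    ∃ (M : Submodule R V) (F : (R × R × M) ≃ₗ[R] V),
      (∀ x y, h (F x) (F y) = hypSum α (h.restrict M) x y) ∧ F (1, 0, 0) = e ∧
      (h.restrict M).IsNegDef ∧ (h.restrict M).Perfect α := by
  have hα0 := hα.ne_zero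
  obtain ⟨u, hu, hcu⟩ := hα.cj_assoc
  have he0 : e ≠ 0 := by
    rintro rfl
    exact not_isUnit_zero (hprim 0 0 (zero_smul _ _).symm)
  obtain ⟨g, e', f₀, hge, hf₀⟩ := P.exists_dual hα0 he0
  obtain ⟨g', hg'⟩ := (hprim g e' hge).exists_right_inv
  -- Primitivity makes g a unit, so f₀ only needs rescaling by its inverse, conjugated.
  obtain ⟨f₁, hef₁⟩ : ∃ f₁, h e f₁ = α := ⟨cj g' • f₀, by
    rw [map_smul, hge, smul_left, hf₀, smul_eq_mul, ← mul_assoc, ← map_mul, mul_comm g', hg',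
      map_one, one_mul]⟩
  have hfe₁ : h f₁ e = cj α := by rw [← h.cj_apply, hef₁]
  obtain ⟨n, hn⟩ := P.dvd_sq hα f₁
  have hff₁ : h f₁ f₁ = p * n := by rw [← coe_sq, hn]; push_cast; rfl
  -- The norm pn of f₁ changes by -n(α + ᾱ) = -np, which makes f isotropic.
  set f := f₁ + (-n : R) • e with hf
  have hef : h e f = α := by rw [hf, map_add, map_smul, hef₁, he]; simp
  have hfe : h f e = cj α := by rw [← h.cj_apply, hef]
  have hff : h f f = 0 := by
    rw [hf]
    simp only [map_add_left, smul_left, map_add, map_smul, smul_eq_mul, map_neg, map_intCast,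
      he, hef₁, hfe₁, hff₁]
    linear_combination (-n : R) * hα.add_cj
  let M : Submodule R V := LinearMap.ker (h e) ⊓ LinearMap.ker (h f)
  have hMe : ∀ m : M, h e m.1 = 0 := fun m => m.2.1
  have hMf : ∀ m : M, h f m.1 = 0 := fun m => m.2.2
  have hMe' : ∀ m : M, h m.1 e = 0 := fun m => h.apply_eq_zero_comm (hMe m)
  have hMf' : ∀ m : M, h m.1 f = 0 := fun m => h.apply_eq_zero_comm (hMf m)
  let F₀ : (R × R × M) →ₗ[R] V := (LinearMap.toSpanSingleton R V e).coprod
    ((LinearMap.toSpanSingleton R V f).coprod M.subtype)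
  have hF₀ : ∀ x : R × R × M, F₀ x = x.1 • e + (x.2.1 • f + x.2.2.1) := fun x => rfl
  have hF₀e : ∀ x, h e (F₀ x) = α * x.2.1 := fun x => by
    rw [hF₀]; simp only [map_add, map_smul, smul_eq_mul, he, hef, hMe]; ring
  have hF₀f : ∀ x, h f (F₀ x) = cj α * x.1 := fun x => by
    rw [hF₀]; simp only [map_add, map_smul, smul_eq_mul, hfe, hff, hMf]; ring
  -- Projection to the plane is integral because α divides every value of the form.
  have hdec : ∀ v, ∃ (a b : R) (m : M), v = a • e + (b • f + m.1) := by
    intro v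
    obtain ⟨b, hb⟩ := P.1 e v
    obtain ⟨a, ha⟩ := P.1 f v
    have hua : h f v = cj α * (cj u * a) := by
      rw [ha, hcu]; linear_combination (-α * a) * hu
    refine ⟨cj u * a, b, ⟨v - (cj u * a) • e - b • f, ?_, ?_⟩, by simp⟩
    · change h e _ = 0
      simp only [map_sub, map_smul, smul_eq_mul, he, hef, hb]; ring
    · change h f _ = 0
      simp only [map_sub, map_smul, smul_eq_mul, hfe, hff, hua]; ring
  have hbij : Function.Bijective F₀ := by
    refine ⟨(injective_iff_map_eq_zero F₀).2 fun x hx => ?_, fun v => ?_⟩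
    · have h1 := hF₀e x
      have h2 := hF₀f x
      rw [hx, map_zero] at h1 h2
      have h3 := (mul_eq_zero.1 h1.symm).resolve_left hα0
      have h4 := (mul_eq_zero.1 h2.symm).resolve_left (cj_ne_zero hα0)
      have h5 := hF₀ x
      rw [hx, h3, h4, zero_smul, zero_smul, zero_add, zero_add] at h5
      ext1
      · exact h4
      · ext1
        · exact h3
        · exact Subtype.ext h5.symm
    · obtain ⟨a, b, m, rfl⟩ := hdec v
      exact ⟨(a, b, m), rfl⟩
  refine ⟨M, LinearEquiv.ofBijective F₀ hbij, fun x y => ?_, ?_, ?_, ?_, fun φ => ?_⟩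
  · rw [LinearEquiv.ofBijective_apply, LinearEquiv.ofBijective_apply, hypSum_apply, hF₀, hF₀]
    simp only [map_add_left, smul_left, map_add, map_smul, smul_eq_mul, he, hef, hfe, hff, hMe, hMf,
      hMe', hMf', restrict_apply]
    ring
  · rw [LinearEquiv.ofBijective_apply, hF₀]
    simp
  · rw [isNegDef_iff]
    intro m hm
    rw [restrict_sq]
    have hpos : 0 < h.sq (e + cj α • f) := by
      rw [sq_eq (n := 2 * p)]
      · have := hα.pos
        omega
      · simp only [map_add_left, smul_left, map_add, map_smul, smul_eq_mul, he, hef, hfe, hff,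
          cj_cj]
        push_cast
        linear_combination 2 * hα.mul_cj
    refine H.sq_neg hpos ?_ fun h0 => hm (Subtype.ext h0)
    rw [map_add_left, smul_left, hMe, hMf, mul_zero, add_zero]
  · exact fun x y => P.1 _ _
  · let E := LinearEquiv.ofBijective F₀ hbij
    obtain ⟨y, hy⟩ := P.2 (φ ∘ₗ LinearMap.snd R R M ∘ₗ LinearMap.snd R R (R × M) ∘ₗ
      (E.symm : V →ₗ[R] R × R × M))
    obtain ⟨a, b, m, rfl⟩ := hdec y
    refine ⟨m, fun x => ?_⟩
    have h1 := hy x.1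
    have h2 : E.symm x.1 = (0, 0, x) := by
      rw [LinearEquiv.symm_apply_eq]
      change x.1 = F₀ (0, 0, x)
      rw [hF₀]
      simp
    simp only [LinearMap.comp_apply, LinearEquiv.coe_coe, h2, LinearMap.snd_apply] at h1
    rw [restrict_apply, ← h1]
    simp only [map_add_left, smul_left, hMe, hMf, mul_zero, zero_add]

/-- In `H ⊕ L` the quotient `e^⊥ / e` is `L`. -/
theorem isometric_perpQuot {α : R} (hα0 : α ≠ 0) {l : HermitianForm R L}
    (F : (R × R × L) ≃ₗ[R] V) (hF : ∀ x y, h (F x) (F y) = hypSum α l x y) :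
    Isometric l (h.perpQuotForm (F (1, 0, 0))) := by
  set e := F (1, 0, 0) with he
  have hperp : ∀ x, h e (F x) = α * x.2.1 := fun x => by
    rw [he, hF, hypSum_apply]
    simp [zero_left]
  let G : L →ₗ[R] h.perp e := ((F : (R × R × L) →ₗ[R] V) ∘ₗ LinearMap.inr R R (R × L) ∘ₗ
    LinearMap.inr R R L).codRestrict _ fun x => by
      change h e (F (0, 0, x)) = 0
      rw [hperp, mul_zero]
  have hG : ∀ x, (G x).1 = F (0, 0, x) := fun x => rfl
  let Q : L →ₗ[R] h.PerpQuot e := (h.lineInPerp e).mkQ ∘ₗ G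
  have hQ : Function.Bijective Q := by
    refine ⟨(injective_iff_map_eq_zero Q).2 fun x hx => ?_, fun y => ?_⟩
    · have h1 : G x ∈ h.lineInPerp e := (Submodule.Quotient.mk_eq_zero _).1 hx
      obtain ⟨a, ha⟩ := Submodule.mem_span_singleton.1 (show (G x).1 ∈ R ∙ e from h1)
      rw [hG, he, ← map_smul] at ha
      have h2 := F.injective ha
      have h3 := congrArg (fun z => z.2.2) h2
      simpa using h3.symm
    · induction y using Submodule.Quotient.induction_on with
      | _ y =>
        obtain ⟨x, hx⟩ := F.surjective y.1
        have h1 : h e y.1 = 0 := y.2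
        rw [← hx, hperp] at h1
        have h2 := (mul_eq_zero.1 h1).resolve_left hα0
        refine ⟨x.2.2, ?_⟩
        refine (Submodule.Quotient.eq _).2 ?_
        change (G x.2.2 - y).1 ∈ R ∙ e
        refine Submodule.mem_span_singleton.2 ⟨-x.1, ?_⟩
        rw [Submodule.coe_sub, hG, ← hx, he, ← map_smul, ← map_sub]
        congr 1
        ext <;> simp [h2]
  refine ⟨LinearEquiv.ofBijective Q hQ, fun x y => ?_⟩
  change h (G x).1 (G y).1 = l x y
  rw [hG, hG, hF, hypSum_apply]
  simp

end Hyperbolic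

end HermitianForm

end HermLat

/-! ### The arithmetic of ℤ[ζ] and of 1 + ζ. -/

namespace HermLat

open NormEuclidean (cj)

section Instance

variable {ζ : ℂ} {t : ℤ}

theorem exists_coords (ht : ζ ^ 2 = t * ζ - 1) (r : CycInt ζ) :
    ∃ a b : ℤ, (r : ℂ) = a + b * ζ := by
  obtain ⟨r, hr⟩ := r
  induction hr using Algebra.adjoin_induction with
  | mem x hx =>
    obtain rfl := Set.mem_singleton_iff.1 hx
    exact ⟨0, 1, by simp⟩
  | algebraMap n => exact ⟨n, 0, by simp⟩
  | add x y _ _ hx hy =>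
    obtain ⟨a, b, h1⟩ := hx
    obtain ⟨c, d, h2⟩ := hy
    exact ⟨a + c, b + d, by push_cast; simp only at h1 h2; rw [h1, h2]; ring⟩
  | mul x y _ _ hx hy =>
    obtain ⟨a, b, h1⟩ := hx
    obtain ⟨c, d, h2⟩ := hy
    refine ⟨a * c - b * d, a * d + b * c + b * d * t, ?_⟩
    push_cast
    simp only at h1 h2
    rw [h1, h2]
    linear_combination (b * d : ℂ) * ht

variable (ζ) in
/-- The generator `ζ` of `ℤ[ζ]`. -/
def gen : CycInt ζ := ⟨ζ, Algebra.subset_adjoin rfl⟩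

theorem exists_coords' (ht : ζ ^ 2 = t * ζ - 1) (r : CycInt ζ) :
    ∃ a b : ℤ, r = a + b * gen ζ := by
  obtain ⟨a, b, h⟩ := exists_coords ht r
  exact ⟨a, b, Subtype.ext (by rw [h]; push_cast; rfl)⟩

theorem conj_mem (hc : conj ζ = t - ζ) (r : CycInt ζ) : conj (r : ℂ) ∈ CycInt ζ := by
  obtain ⟨r, hr⟩ := r
  induction hr using Algebra.adjoin_induction with
  | mem x hx =>
    obtain rfl := Set.mem_singleton_iff.1 hx
    change conj x ∈ _
    rw [hc]
    exact sub_mem (by simp) (Algebra.subset_adjoin rfl)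
  | algebraMap n => simp
  | add x y _ _ hx hy => simpa using add_mem hx hy
  | mul x y _ _ hx hy => simpa using mul_mem hx hy

/-- For odd p not dividing 4 - t², the form x² + (4 - t²) y² takes every value modulo p. The prime
3, when it divides 4 - t², is itself a norm, and for p = 2 the norms 0 and 1 suffice. -/
theorem exists_norm_residue (ht : t = -1 ∨ t = 0 ∨ t = 1) (p : ℕ) (hp : p.Prime) :
    (∃ a b : ℤ, a ^ 2 + t * a * b + b ^ 2 = p) ∨
      ∀ n : ℤ, ∃ a b m : ℤ, a ^ 2 + t * a * b + b ^ 2 = n + p * m := by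
  by_cases h2 : p = 2
  · subst h2
    refine Or.inr fun n => ?_
    rcases Int.even_or_odd' n with ⟨m, hm | hm⟩
    · exact ⟨0, 0, -m, by rw [hm]; push_cast; ring⟩
    · exact ⟨1, 0, -m, by rw [hm]; push_cast; ring⟩
  have := Fact.mk hp
  by_cases h3 : ((4 - t ^ 2 : ℤ) : ZMod p) = 0
  · left
    rw [ZMod.intCast_zmod_eq_zero_iff_dvd] at h3
    rcases ht with rfl | rfl | rfl
    · have : p = 3 := (Nat.prime_dvd_prime_iff_eq hp Nat.prime_three).1 (by
        norm_num at h3; exact_mod_cast h3)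
      exact ⟨1, -1, by rw [this]; norm_num⟩
    · have : p = 2 := (Nat.prime_dvd_prime_iff_eq hp Nat.prime_two).1 (by
        norm_num at h3
        have h4 : p ∣ 2 ^ 2 := by exact_mod_cast h3
        exact hp.dvd_of_dvd_pow h4)
      exact absurd this h2
    · have : p = 3 := (Nat.prime_dvd_prime_iff_eq hp Nat.prime_three).1 (by
        norm_num at h3; exact_mod_cast h3)
      exact ⟨1, 1, by rw [this]; norm_num⟩
  · refine Or.inr fun n => ?_
    have hodd : Fintype.card (ZMod p) % 2 = 1 := by
      rw [ZMod.card]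
      exact Nat.odd_iff.1 (hp.odd_of_ne_two h2)
    obtain ⟨x, y, hxy⟩ := FiniteField.exists_root_sum_quadratic
      (f := (Polynomial.X ^ 2 - Polynomial.C (n : ZMod p)))
      (g := Polynomial.C ((4 - t ^ 2 : ℤ) : ZMod p) * Polynomial.X ^ 2)
      (Polynomial.degree_X_pow_sub_C (by norm_num) _)
      (by rw [Polynomial.degree_C_mul h3, Polynomial.degree_X_pow]; rfl) hodd
    simp only [Polynomial.eval_sub, Polynomial.eval_pow, Polynomial.eval_X, Polynomial.eval_C,
      Polynomial.eval_mul] at hxy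
    obtain ⟨x, rfl⟩ := ZMod.intCast_surjective x
    obtain ⟨y, rfl⟩ := ZMod.intCast_surjective y
    have h4 : ((x ^ 2 - n + (4 - t ^ 2) * y ^ 2 : ℤ) : ZMod p) = 0 := by
      push_cast
      push_cast at hxy
      exact hxy
    rw [ZMod.intCast_zmod_eq_zero_iff_dvd] at h4
    obtain ⟨m, hm⟩ := h4
    -- This substitution diagonalizes the norm form to x² + (4 - t²) y² without denominators.
    exact ⟨x - t * y, 2 * y, m, by linear_combination hm⟩

/-- The structure of a `NormEuclidean` ring on `ℤ[ζ]`, for `ζ² = tζ - 1` with `|t| ≤ 1`. -/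
noncomputable abbrev normEuclidean (ht : t = -1 ∨ t = 0 ∨ t = 1) (h2 : ζ ^ 2 = t * ζ - 1)
    (hc : conj ζ = t - ζ) (him : ζ.im ≠ 0) : NormEuclidean (CycInt ζ) :=
  let c : CycInt ζ →+* CycInt ζ :=
    ((starRingEnd ℂ).comp (CycInt ζ).val.toRingHom).codRestrict (CycInt ζ).toSubring
      (fun r => conj_mem hc r)
  have hcc : ∀ r : CycInt ζ, (c r : ℂ) = conj (r : ℂ) := fun _ => rfl
  have hg : c (gen ζ) = t - gen ζ := Subtype.ext (by rw [hcc]; push_cast; exact hc)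
  have hg2 : gen ζ ^ 2 = t * gen ζ - 1 := Subtype.ext (by push_cast; exact h2)
  { cj := c
    coe_cj := hcc
    real_int := fun r hr => by
      obtain ⟨a, b, rfl⟩ := exists_coords' h2 r
      refine ⟨a, ?_⟩
      have h1 := congrArg (fun x : CycInt ζ => (x : ℂ).im) hr
      have h3 : ((a + b * gen ζ : CycInt ζ) : ℂ) = a + b * ζ := by push_cast; rfl
      simp only [hcc, h3, Complex.conj_im, Complex.add_im, Complex.intCast_im, Complex.mul_im,
        Complex.intCast_re] at h1
      have h4 : (b : ℝ) * ζ.im = 0 := by linarith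
      have h5 : b = 0 := by exact_mod_cast (mul_eq_zero.1 h4).resolve_right him
      rw [h5]
      simp
    approx := fun z => by
      have hre : 2 * ζ.re = t := by
        have := congrArg Complex.re hc
        simp at this
        linarith
      have him2 : ζ.im ^ 2 ≤ 1 := by
        have h1 := congrArg Complex.re h2
        simp [pow_two] at h1
        rw [← hre] at h1
        nlinarith [sq_nonneg ζ.re]
      -- Rounding the ζ-coordinate and then the real part leaves errors at most |Im ζ|/2 and 1/2;
      -- with |Im ζ| ≤ 1 the squared distance is at most 1/2.
      let y := z.im / ζ.im
      let b := round y
      let x := z.re - b * ζ.re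
      let a := round x
      refine ⟨a + b * gen ζ, ?_⟩
      have h3 : ((a + b * gen ζ : CycInt ζ) : ℂ) = a + b * ζ := by push_cast; rfl
      have h4 : z.im = y * ζ.im := (div_mul_cancel₀ _ him).symm
      have hy := abs_sub_round y
      have hx := abs_sub_round x
      rw [h3, Complex.normSq_apply]
      simp only [Complex.sub_re, Complex.add_re, Complex.intCast_re, Complex.mul_re,
        Complex.intCast_im, Complex.sub_im, Complex.add_im, Complex.mul_im]
      have e1 : z.re - (a + (b * ζ.re - 0 * ζ.im)) = x - a := by simp only [x]; ring
      have e2 : z.im - (0 + (b * ζ.im + 0 * ζ.re)) = (y - b) * ζ.im := by rw [h4]; ring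
      rw [e1, e2]
      have h5 : (x - a) ^ 2 ≤ (1 / 2) ^ 2 := sq_le_sq' (abs_le.1 hx).1 (abs_le.1 hx).2
      have h6 : (y - b) ^ 2 ≤ (1 / 2) ^ 2 := sq_le_sq' (abs_le.1 hy).1 (abs_le.1 hy).2
      nlinarith [mul_le_mul h6 him2 (sq_nonneg _) (by norm_num)]
    norm_residue := fun p hp => by
      have key : ∀ a b : ℤ, (a + b * gen ζ) * c (a + b * gen ζ) =
          ((a ^ 2 + t * a * b + b ^ 2 : ℤ) : CycInt ζ) := fun a b => by
        rw [map_add, map_mul, map_intCast, map_intCast, hg]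
        push_cast
        linear_combination (-b ^ 2 : CycInt ζ) * hg2
      rcases exists_norm_residue ht p hp with ⟨a, b, h⟩ | h
      · exact Or.inl ⟨a + b * gen ζ, by rw [key, h]; simp⟩
      · refine Or.inr fun n => ?_
        obtain ⟨a, b, m, h⟩ := h n
        exact ⟨a + b * gen ζ, m, by rw [key, h]; push_cast; rfl⟩
    trace_parity := fun n => by
      have key : ∀ a b : ℤ, (a + b * gen ζ) + c (a + b * gen ζ) =
          ((2 * a + t * b : ℤ) : CycInt ζ) := fun a b => by
        rw [map_add, map_mul, map_intCast, map_intCast, hg]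
        push_cast
        ring
      rcases Int.even_or_odd' n with ⟨m, hm | hm⟩
      · exact Or.inl ⟨m + (0 : ℤ) * gen ζ, by rw [key, hm]; simp⟩
      · exact Or.inr ⟨m + (0 : ℤ) * gen ζ, by rw [key, hm]; push_cast; ring⟩ }

theorem cj_gen (ht : t = -1 ∨ t = 0 ∨ t = 1) (h2 : ζ ^ 2 = t * ζ - 1)
    (hc : conj ζ = t - ζ) (him : ζ.im ≠ 0) :
    letI := normEuclidean ht h2 hc him
    cj (gen ζ) = t - gen ζ := Subtype.ext (by push_cast; exact hc)

theorem isModulus_one_add (ht : t = -1 ∨ t = 0 ∨ t = 1) (h2 : ζ ^ 2 = t * ζ - 1)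
    (hc : conj ζ = t - ζ) (him : ζ.im ≠ 0) :
    letI := normEuclidean ht h2 hc him
    IsModulus (1 + gen ζ) (2 + t) := by
  let := normEuclidean ht h2 hc him
  have hg : cj (gen ζ) = t - gen ζ := cj_gen ht h2 hc him
  have hg2 : gen ζ ^ 2 = t * gen ζ - 1 := Subtype.ext (by push_cast; exact h2)
  have hmul : (1 + gen ζ) * cj (1 + gen ζ) = ((2 + t : ℤ) : CycInt ζ) := by
    rw [map_add, map_one, hg]
    push_cast
    linear_combination (-1 : CycInt ζ) * hg2
  have hdvd : ∀ n : ℤ, (1 + gen ζ) ∣ (n : CycInt ζ) → 2 + t ∣ n := by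
    rintro n ⟨d, hd⟩
    have h1 := congrArg nrm hd
    have h3 : nrm (1 + gen ζ) = 2 + t := by
      rw [← intCast_inj' (R := CycInt ζ), coe_nrm, hmul]
    rw [nrm_intCast, nrm_mul, h3] at h1
    have h4 : 2 + t ∣ n ^ 2 := ⟨_, h1⟩
    rcases ht with rfl | rfl | rfl
    · exact one_dvd _
    · exact Int.prime_two.dvd_of_dvd_pow h4
    · exact Int.prime_three.dvd_of_dvd_pow h4
  refine ⟨?_, hmul, ?_, ⟨t - gen ζ, ?_, ?_⟩, ?_, ?_, ?_⟩
  · rcases ht with rfl | rfl | rfl <;> norm_num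
  · rw [map_add, map_one, hg]
    push_cast
    ring
  · rw [map_sub, map_intCast, hg]
    linear_combination (-1 : CycInt ζ) * hg2
  · rw [map_add, map_one, hg]
    linear_combination hg2
  · exact hdvd
  · intro r
    obtain ⟨a, b, rfl⟩ := exists_coords' h2 r
    have hp : (1 + gen ζ) ∣ ((2 + t : ℤ) : CycInt ζ) := ⟨_, hmul.symm⟩
    -- Since ζ ≡ -1 modulo α, a + bζ reduces to a - b modulo p, and p ≤ 3 leaves only the residues
    -- 0, 1, -1.
    have key : ∀ m : ℤ, 2 + t ∣ (a - b) - m → (1 + gen ζ) ∣ (a + b * gen ζ) - (m : CycInt ζ) := by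
      rintro m ⟨d, hd⟩
      have h5 : (a + b * gen ζ) - (m : CycInt ζ) =
          ((2 + t : ℤ) : CycInt ζ) * d + (1 + gen ζ) * b := by
        have := congrArg (fun x : ℤ => (x : CycInt ζ)) hd
        push_cast at this ⊢
        linear_combination this
      rw [h5]
      exact dvd_add (hp.mul_right _) (dvd_mul_right _ _)
    have : 2 + t ∣ (a - b) - 0 ∨ 2 + t ∣ (a - b) - 1 ∨ 2 + t ∣ (a - b) - (-1) := by
      rcases ht with rfl | rfl | rfl
      · exact Or.inl ⟨a - b, by ring⟩
      · rw [show (2 + 0 : ℤ) = 2 from rfl]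
        omega
      · rw [show (2 + 1 : ℤ) = 3 from rfl]
        omega
    rcases this with h | h | h
    · exact Or.inl (by simpa using key _ h)
    · exact Or.inr (Or.inl (by simpa using key _ h))
    · exact Or.inr (Or.inr (by simpa using key _ h))
  · intro n hn
    have hn' : 2 + t ∣ n + 2 := hdvd _ (by push_cast; exact hn)
    have tr : ∀ a b : ℤ, ((2 + t : ℤ) : CycInt ζ) * ((a : CycInt ζ) + (b : CycInt ζ) * gen ζ) +
        cj (((2 + t : ℤ) : CycInt ζ) * ((a : CycInt ζ) + (b : CycInt ζ) * gen ζ)) =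
          (((2 + t) * (2 * a + t * b) : ℤ) : CycInt ζ) := fun a b => by
      rw [map_mul, map_add, map_mul, map_intCast, map_intCast, map_intCast, hg]
      push_cast
      ring
    obtain ⟨m, hm⟩ := hn'
    -- If t = ±1, traces of multiples of p fill pℤ, so the norm n can be moved to -2 and c = -1
    -- gives a reflection. If t = 0 they fill only 4ℤ, so n moves to -2, with c = -1, or to 0, with
    -- c = ζ of trace zero and c + 1 = α.
    by_cases ht0 : t = 0
    · subst ht0
      rcases Int.even_or_odd' m with ⟨d, hd | hd⟩
      · refine ⟨(-d : ℤ) + (0 : ℤ) * gen ζ, -1, by simp, ?_⟩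
        rw [tr, ← Int.cast_add]
        have : n + (2 + 0) * (2 * -d + 0 * 0) = -2 := by linarith
        rw [this]
        simp
        norm_num
      · refine ⟨(-d : ℤ) + (0 : ℤ) * gen ζ, gen ζ, by rw [add_comm], ?_⟩
        rw [tr, ← Int.cast_add, hg]
        have : n + (2 + 0) * (2 * -d + 0 * 0) = 0 := by linarith
        rw [this]
        simp
    · have htt : t * t = 1 := by
        rcases ht with rfl | rfl | rfl
        · norm_num
        · exact absurd rfl ht0
        · norm_num
      refine ⟨(0 : ℤ) + (-(t * m) : ℤ) * gen ζ, -1, by simp, ?_⟩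
      rw [tr, ← Int.cast_add]
      have : n + (2 + t) * (2 * 0 + t * -(t * m)) = -2 := by
        linear_combination hm - (2 + t) * m * htt
      rw [this]
      simp
      norm_num

end Instance

end HermLat

/-! ### From the complexified definitions to the arithmetic ones. -/

namespace HermLat

open NormEuclidean (cj)

namespace HermitianForm

section Complexify

variable {R : Subalgebra ℤ ℂ} {V : Type u} [AddCommGroup V] [Module R V] (h : HermitianForm R V)

theorem complexify_tmul_right (w : ℂ ⊗[R] V) (c : ℂ) (y : V) :
    h.complexify w (c ⊗ₜ y) = c * conj (h.extendRight y w) := by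
  simp [complexify, functional]

theorem complexify_add_left (w w' z : ℂ ⊗[R] V) :
    h.complexify (w + w') z = h.complexify w z + h.complexify w' z := by
  induction z using TensorProduct.induction_on with
  | zero => simp
  | tmul c y => simp only [complexify_tmul_right, map_add]; ring
  | add a b ha hb => simp only [map_add, ha, hb]; ring

theorem complexify_smul_left (a : ℂ) (w z : ℂ ⊗[R] V) :
    h.complexify (a • w) z = conj a * h.complexify w z := by
  induction z using TensorProduct.induction_on with
  | zero => simp
  | tmul c y => simp only [complexify_tmul_right, map_smul, smul_eq_mul, map_mul]; ring
  | add a b ha hb => simp only [map_add, ha, hb]; ring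

/-- `w ↦ w ⋆ z` as an additive map. -/
noncomputable def complexifyLeft (z : ℂ ⊗[R] V) : (ℂ ⊗[R] V) →+ ℂ :=
  AddMonoidHom.mk' (fun w => h.complexify w z) fun w w' => h.complexify_add_left w w' z

theorem complexify_sum_smul_left {ι : Type*} (s : Finset ι) (a : ι → ℂ) (w : ι → ℂ ⊗[R] V)
    (z : ℂ ⊗[R] V) :
    h.complexify (∑ i ∈ s, a i • w i) z = ∑ i ∈ s, conj (a i) * h.complexify (w i) z := by
  have := map_sum (h.complexifyLeft z) (fun i => a i • w i) s
  refine this.trans (Finset.sum_congr rfl fun i _ => ?_)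
  exact h.complexify_smul_left _ _ _

theorem complexify_one_tmul (x y : V) : h.complexify (1 ⊗ₜ x) (1 ⊗ₜ y) = (h x y : ℂ) := by
  rw [complexify_tmul]
  simp

theorem complexify_right_eq_functional (w : ℂ ⊗[R] V) (y : V) :
    h.complexify w (1 ⊗ₜ y) = h.functional w y := by
  rw [complexify_tmul_right, one_mul]
  rfl

end Complexify

variable {R : Subalgebra ℤ ℂ} [NormEuclidean R]
  {V : Type u} [AddCommGroup V] [Module R V] {h : HermitianForm R V}

omit [NormEuclidean R] in
theorem one_tmul_injective [Module.Free R V] {x : V}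
    (hx : (1 : ℂ) ⊗ₜ[R] x = 0) : x = 0 := by
  let b := Module.Free.chooseBasis R V
  rw [← b.forall_coord_eq_zero_iff]
  intro i
  have h1 : (Algebra.TensorProduct.basis ℂ b).repr ((1 : ℂ) ⊗ₜ[R] x) i = 0 := by
    rw [hx]
    simp
  rw [Algebra.TensorProduct.basis_repr_tmul] at h1
  simpa using h1

section Gram

variable {ι : Type*} [Fintype ι] [DecidableEq ι]

/-- The complex Gram matrix of a nondegenerate form is invertible. -/
theorem isUnit_det_gram (b : Module.Basis ι R V) (hnd : ∀ x, (∀ y, h x y = 0) → x = 0) :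
    IsUnit (Matrix.of fun i j => (h (b i) (b j) : ℂ)).det := by
  have hdet : (Matrix.of fun i j => h (b i) (b j)).det ≠ 0 := by
    intro h0
    obtain ⟨v, hv0, hv⟩ := Matrix.exists_vecMul_eq_zero_iff.2 h0
    have hx : ∑ i, cj (v i) • b i = 0 := by
      refine hnd _ fun y => ?_
      suffices H : h (∑ i, cj (v i) • b i) = 0 by rw [H, LinearMap.zero_apply]
      refine b.ext fun j => ?_
      rw [sum_left, LinearMap.zero_apply]
      have := congrFun hv j
      simpa [Matrix.vecMul, dotProduct, smul_left] using this
    have h1 := Fintype.linearIndependent_iff.1 b.linearIndependent _ hx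
    exact hv0 (funext fun i => by
      have := h1 i
      rw [← cj_cj (v i), this, map_zero]
      rfl)
  have e : (Matrix.of fun i j => (h (b i) (b j) : ℂ)) =
      (algebraMap R ℂ).mapMatrix (Matrix.of fun i j => h (b i) (b j)) := by
    ext i j
    rfl
  rw [e, ← RingHom.map_det, isUnit_iff_ne_zero]
  intro h0
  exact hdet (Subtype.ext h0)

end Gram

variable [Module.Free R V] [Module.Finite R V]

/-- Every functional on the lattice comes from a unique vector of the complexification. -/
theorem exists_functional_eq (hnd : ∀ x, (∀ y, h x y = 0) → x = 0) (φ : V →ₗ[R] ℂ) :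
    ∃ w, h.functional w = φ := by
  classical
  let b := Module.Free.chooseBasis R V
  have hu := isUnit_det_gram b hnd
  set G := Matrix.of fun i j => (h (b i) (b j) : ℂ) with hG
  let c := Matrix.vecMul (fun j => φ (b j)) G⁻¹
  refine ⟨∑ i, conj (c i) • (1 ⊗ₜ b i), b.ext fun j => ?_⟩
  rw [← complexify_right_eq_functional, complexify_sum_smul_left]
  simp only [complexify_one_tmul, Complex.conj_conj]
  have h1 : Matrix.vecMul c G = fun j => φ (b j) := by
    simp only [c]
    rw [Matrix.vecMul_vecMul, Matrix.nonsing_inv_mul _ hu, Matrix.vecMul_one]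
  exact congrFun h1 j

theorem eq_zero_of_functional_eq_zero (hnd : ∀ x, (∀ y, h x y = 0) → x = 0) {w : ℂ ⊗[R] V}
    (hw : h.functional w = 0) : w = 0 := by
  classical
  let b := Module.Free.chooseBasis R V
  have hu := isUnit_det_gram b hnd
  let B := Algebra.TensorProduct.basis ℂ b
  have hsum : w = ∑ i, B.repr w i • ((1 : ℂ) ⊗ₜ[R] b i) := by
    conv_lhs => rw [← B.sum_repr w]
    simp only [B, Algebra.TensorProduct.basis_apply]
  have h1 : Matrix.vecMul (fun i => conj (B.repr w i))
      (Matrix.of fun i j => (h (b i) (b j) : ℂ)) = 0 := by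
    funext j
    have h2 : h.complexify w (1 ⊗ₜ b j) = 0 := by
      rw [complexify_right_eq_functional, hw, LinearMap.zero_apply]
    rw [hsum, complexify_sum_smul_left] at h2
    simp only [complexify_one_tmul] at h2
    exact h2
  have h3 := Matrix.eq_zero_of_vecMul_eq_zero hu.ne_zero h1
  refine B.ext_elem fun i => ?_
  have := congrFun h3 i
  simpa using this

/-- By nondegeneracy V ⊗ ℂ is the space of complex functionals on V, with the dual corresponding to
Hom(V, R). Multiplying w by α multiplies its functional by ᾱ = uα, and the unit u does not affect
the submodule α Hom(V, R). -/
theorem isModular_iff_perfect {α : R} {p : ℤ} (hα : IsModulus α p)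
    (hnd : ∀ x, (∀ y, h x y = 0) → x = 0) : h.IsModular (α : ℂ) ↔ h.Perfect α := by
  obtain ⟨u, hu, hcu⟩ := hα.cj_assoc
  have hα0 : (α : ℂ) ≠ 0 := fun h0 => hα.ne_zero (Subtype.ext h0)
  have hcα0 : conj (α : ℂ) ≠ 0 := by simpa using hα0
  constructor
  · intro H
    refine ⟨fun x y => ?_, fun φ => ?_⟩
    · obtain ⟨w, hw, hwx⟩ : (1 : ℂ) ⊗ₜ[R] x ∈ (fun w => (α : ℂ) • w) '' h.dual :=
        H ▸ ⟨x, rfl⟩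
      have hwx' : (α : ℂ) • w = (1 : ℂ) ⊗ₜ[R] x := hwx
      refine ⟨u * ⟨_, hw y⟩, Subtype.ext ?_⟩
      rw [← mul_assoc, mul_comm α, ← hcu]
      push_cast
      rw [NormEuclidean.coe_cj, ← complexify_smul_left, hwx', complexify_one_tmul]
    · obtain ⟨w, hw⟩ := exists_functional_eq hnd (Algebra.linearMap R ℂ ∘ₗ (cj u • φ))
      have hw' : ∀ y, h.complexify w (1 ⊗ₜ y) = ((cj u * φ y : R) : ℂ) := fun y => by
        rw [complexify_right_eq_functional, hw]
        rfl
      obtain ⟨y, hy⟩ : (α : ℂ) • w ∈ Set.range (fun y : V => (1 : ℂ) ⊗ₜ[R] y) :=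
        H ▸ ⟨w, fun y => by rw [hw']; exact Subtype.property _, rfl⟩
      refine ⟨y, fun x => Subtype.ext ?_⟩
      have e : α * φ x = cj α * (cj u * φ x) := by
        rw [hcu]
        linear_combination (-α * φ x) * hu
      have hy' : (1 : ℂ) ⊗ₜ[R] y = (α : ℂ) • w := hy
      rw [← complexify_one_tmul, hy', complexify_smul_left, hw', e]
      push_cast
      rw [NormEuclidean.coe_cj α]
  · intro H
    ext w
    constructor
    · rintro ⟨y, rfl⟩
      refine ⟨(α : ℂ)⁻¹ • (1 ⊗ₜ y), fun x => ?_, by simp [smul_smul, hα0]⟩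
      obtain ⟨c, hc⟩ := H.1 y x
      have e : h y x = cj α * (cj u * c) := by
        rw [hc, hcu]
        linear_combination (-α * c) * hu
      rw [complexify_smul_left, complexify_one_tmul, e]
      push_cast
      rw [NormEuclidean.coe_cj α, map_inv₀, inv_mul_cancel_left₀ hcα0]
      exact_mod_cast Subtype.property (cj u * c)
    · rintro ⟨w, hw, rfl⟩
      let φ : V →ₗ[R] R :=
        { toFun := fun y => ⟨_, hw y⟩
          map_add' := fun x y => Subtype.ext (by
            push_cast
            simp only [complexify_right_eq_functional, map_add])
          map_smul' := fun a x => Subtype.ext (by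
            simp only [complexify_right_eq_functional, map_smul, RingHom.id_apply]
            rfl) }
      obtain ⟨y, hy⟩ := H.2 (u • φ)
      refine ⟨y, ?_⟩
      change (1 : ℂ) ⊗ₜ[R] y = (α : ℂ) • w
      rw [← sub_eq_zero]
      refine eq_zero_of_functional_eq_zero hnd (LinearMap.ext fun x => ?_)
      rw [← complexify_right_eq_functional, sub_eq_add_neg, complexify_add_left,
        ← neg_smul, complexify_smul_left, complexify_one_tmul, hy]
      have e : α * (u • φ) x = cj α * φ x := by
        rw [hcu, LinearMap.smul_apply, smul_eq_mul]
        ring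
      rw [e]
      push_cast
      rw [NormEuclidean.coe_cj α, map_neg]
      change _ * h.complexify w (1 ⊗ₜ x) + _ = 0
      ring

omit [NormEuclidean R] [Module.Free R V] [Module.Finite R V] in
theorem IsNegDef.nondegenerate (H : h.IsNegDef) : ∀ x, (∀ y, h x y = 0) → x = 0 := by
  intro x hx
  by_contra hne
  have := H x hne
  rw [hx x] at this
  simp at this

section Signature

variable {s : ℕ}

omit [NormEuclidean R] [Module.Free R V] [Module.Finite R V] in
theorem complexify_eq_of_diagonal (c : Module.Basis (Fin 1 ⊕ Fin s) ℂ (ℂ ⊗[R] V))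
    (hc : ∀ i j, h.complexify (c i) (c j) =
      Matrix.diagonal (Sum.elim (fun _ => (1 : ℂ)) (fun _ => (-1 : ℂ))) i j) (w z : ℂ ⊗[R] V) :
    h.complexify w z = conj (c.repr w (Sum.inl 0)) * c.repr z (Sum.inl 0) -
      ∑ i, conj (c.repr w (Sum.inr i)) * c.repr z (Sum.inr i) := by
  conv_lhs => rw [← c.sum_repr w, ← c.sum_repr z]
  rw [complexify_sum_smul_left]
  simp only [map_sum, map_smul, hc, smul_eq_mul, Matrix.diagonal_apply]
  simp [Fintype.sum_sum_type, sub_eq_add_neg]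

omit [NormEuclidean R] [Module.Finite R V] in
theorem HasSignature.nondegenerate (H : h.HasSignature 1 s) : ∀ x, (∀ y, h x y = 0) → x = 0 := by
  obtain ⟨c, hc⟩ := H
  intro x hx
  refine one_tmul_injective (R := R) (c.ext_elem fun i => ?_)
  have h0 : h.complexify (1 ⊗ₜ x) (c i) = 0 := by
    generalize c i = z
    induction z using TensorProduct.induction_on with
    | zero => simp
    | tmul a y => rw [complexify_tmul, hx]; simp
    | add a b ha hb => rw [map_add, ha, hb, add_zero]
  rw [complexify_eq_of_diagonal c hc] at h0
  rcases i with i | i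
  · fin_cases i
    simpa using h0
  · simpa [Finsupp.single_apply] using h0

omit [NormEuclidean R] [Module.Finite R V] in
theorem HasSignature.finrank_eq (H : h.HasSignature 1 s) : Module.finrank R V = s + 1 := by
  obtain ⟨c, -⟩ := H
  rw [← Module.finrank_baseChange (R := ℂ) (M' := V) (S := R), Module.finrank_eq_card_basis c]
  simp [add_comm]

/-- Positivity of the complexified form at some vector is seen on the lattice. -/
theorem exists_sq_pos {w : ℂ ⊗[R] V} (hw : 0 < (h.complexify w w).re) : ∃ v, 0 < h.sq v := by
  classical
  let b := Module.Free.chooseBasis R V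
  let B := Algebra.TensorProduct.basis ℂ b
  have key : ∀ d : Module.Free.ChooseBasisIndex R V → ℂ,
      h.complexify (∑ i, d i • (1 ⊗ₜ b i)) (∑ i, d i • (1 ⊗ₜ b i)) =
        ∑ i, conj (d i) * ∑ j, d j * (h (b i) (b j) : ℂ) := fun d => by
    rw [complexify_sum_smul_left]
    simp only [map_sum, map_smul, smul_eq_mul, complexify_one_tmul]
  set d := fun i => B.repr w i with hd
  have hsum : w = ∑ i, d i • ((1 : ℂ) ⊗ₜ[R] b i) := by
    conv_lhs => rw [← B.sum_repr w]
    simp only [B, hd, Algebra.TensorProduct.basis_apply]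
  -- Lattice points within bounded distance of n w, divided by n, tend to w; by continuity some of
  -- them are positive, and scaling by n keeps the sign.
  choose r hr using fun (n : ℕ) i => NormEuclidean.approx (R := R) ((n : ℂ) * d i)
  have hlim : ∀ i, Filter.Tendsto (fun n : ℕ => (r n i : ℂ) / n) Filter.atTop (nhds (d i)) := by
    intro i
    rw [tendsto_iff_norm_sub_tendsto_zero]
    refine squeeze_zero' (Filter.Eventually.of_forall fun n => norm_nonneg _) ?_
      tendsto_one_div_atTop_nhds_zero_nat
    filter_upwards [Filter.eventually_gt_atTop 0] with n hn
    have hn' : (0 : ℝ) < n := by exact_mod_cast hn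
    have hnC : (n : ℂ) ≠ 0 := by exact_mod_cast hn.ne'
    have e : (r n i : ℂ) / n - d i = -((n * d i - r n i) / n) := by field_simp; ring
    have h1 := hr n i
    rw [Complex.normSq_eq_norm_sq] at h1
    have h2 : ‖(n : ℂ) * d i - r n i‖ ≤ 1 := by
      nlinarith [norm_nonneg ((n : ℂ) * d i - r n i)]
    rw [e, norm_neg, norm_div, Complex.norm_natCast]
    exact div_le_div_of_nonneg_right h2 hn'.le
  have hlim2 : Filter.Tendsto (fun n : ℕ => (h.complexify (∑ i, ((r n i : ℂ) / n) • (1 ⊗ₜ b i))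
      (∑ i, ((r n i : ℂ) / n) • (1 ⊗ₜ b i))).re) Filter.atTop (nhds (h.complexify w w).re) := by
    simp only [hsum, key]
    refine (Complex.continuous_re.tendsto _).comp ?_
    refine tendsto_finsetSum _ fun i _ => ?_
    refine ((Complex.continuous_conj.tendsto _).comp (hlim i)).mul ?_
    exact tendsto_finsetSum _ fun j _ => (hlim j).mul tendsto_const_nhds
  obtain ⟨n, hn, hn0⟩ := ((hlim2.eventually (lt_mem_nhds hw)).and
    (Filter.eventually_gt_atTop 0)).exists
  have hn' : (0 : ℝ) < n := by exact_mod_cast hn0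
  refine ⟨∑ i, r n i • b i, ?_⟩
  have e1 : ∑ i, ((r n i : ℂ) / n) • ((1 : ℂ) ⊗ₜ[R] b i) =
      ((n : ℂ)⁻¹) • ((1 : ℂ) ⊗ₜ[R] (∑ i, r n i • b i)) := by
    rw [TensorProduct.tmul_sum, Finset.smul_sum]
    refine Finset.sum_congr rfl fun i _ => ?_
    rw [TensorProduct.tmul_smul, TensorProduct.smul_tmul', TensorProduct.smul_tmul',
      TensorProduct.smul_tmul']
    congr 1
    change (r n i : ℂ) / n * 1 = (n : ℂ)⁻¹ * ((r n i : ℂ) * 1)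
    ring
  have e2 : (h.complexify (∑ i, ((r n i : ℂ) / n) • (1 ⊗ₜ b i))
      (∑ i, ((r n i : ℂ) / n) • (1 ⊗ₜ b i))).re =
        (n : ℝ)⁻¹ ^ 2 * h.sq (∑ i, r n i • b i) := by
    rw [e1, complexify_smul_left, map_smul, complexify_one_tmul, ← coe_sq]
    have : conj ((n : ℂ)⁻¹) * ((n : ℂ)⁻¹ • (((h.sq (∑ i, r n i • b i) : ℤ) : R) : ℂ)) =
        (((n : ℝ)⁻¹ ^ 2 * h.sq (∑ i, r n i • b i) : ℝ) : ℂ) := by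
      push_cast
      simp
      ring
    rw [this, Complex.ofReal_re]
  rw [e2] at hn
  have := (mul_pos_iff_of_pos_left (by positivity)).1 hn
  exact_mod_cast this

/-- The reversed Cauchy–Schwarz argument: if v is positive, y ⟂ v and y ⋆ y ≥ 0, Cauchy–Schwarz on
the negative coordinates forces the positive coordinate of y to vanish, hence y = 0. -/
theorem HasSignature.lorentzian (H : h.HasSignature 1 s) : h.Lorentzian := by
  obtain ⟨c, hc⟩ := H
  have hform := complexify_eq_of_diagonal c hc
  have hre : ∀ x : V, (h.sq x : ℝ) = ‖c.repr (1 ⊗ₜ x) (Sum.inl 0)‖ ^ 2 -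
      ∑ i, ‖c.repr (1 ⊗ₜ x) (Sum.inr i)‖ ^ 2 := by
    intro x
    rw [coe_sq_re, ← complexify_one_tmul, hform]
    simp only [Complex.conj_mul']
    have : ∀ z : ℂ, (((‖z‖ : ℝ) : ℂ) ^ 2).re = ‖z‖ ^ 2 := fun z => by
      rw [← Complex.ofReal_pow, Complex.ofReal_re]
    rw [Complex.sub_re, Complex.re_sum]
    simp only [this]
  obtain ⟨v, hv⟩ := exists_sq_pos (h := h) (w := c (Sum.inl 0)) (by rw [hc]; simp)
  refine ⟨v, hv, fun y hy hne => ?_⟩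
  by_contra hcon
  push Not at hcon
  have hv' : (0 : ℝ) < h.sq v := by exact_mod_cast hv
  have hy' : (0 : ℝ) ≤ h.sq y := by exact_mod_cast hcon
  rw [hre] at hv' hy'
  have horth : conj (c.repr (1 ⊗ₜ v) (Sum.inl 0)) * c.repr (1 ⊗ₜ y) (Sum.inl 0) =
      ∑ i, conj (c.repr (1 ⊗ₜ v) (Sum.inr i)) * c.repr (1 ⊗ₜ y) (Sum.inr i) := by
    rw [← sub_eq_zero, ← hform, complexify_one_tmul, hy]
    rfl
  set a := c.repr (1 ⊗ₜ v)
  set b := c.repr (1 ⊗ₜ y) with hb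
  have h1 : ‖a (Sum.inl 0)‖ * ‖b (Sum.inl 0)‖ ≤ ∑ i, ‖a (Sum.inr i)‖ * ‖b (Sum.inr i)‖ := by
    have := congrArg norm horth
    rw [norm_mul, RCLike.norm_conj] at this
    rw [this]
    refine (norm_sum_le _ _).trans (le_of_eq (Finset.sum_congr rfl fun i _ => ?_))
    rw [norm_mul, RCLike.norm_conj]
  have h2 := Finset.sum_mul_sq_le_sq_mul_sq Finset.univ (fun i => ‖a (Sum.inr i)‖)
    (fun i => ‖b (Sum.inr i)‖)
  have h3 : (‖a (Sum.inl 0)‖ * ‖b (Sum.inl 0)‖) ^ 2 ≤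
      (∑ i, ‖a (Sum.inr i)‖ ^ 2) * ∑ i, ‖b (Sum.inr i)‖ ^ 2 :=
    (pow_le_pow_left₀ (by positivity) h1 2).trans h2
  have hA : 0 ≤ ∑ i, ‖a (Sum.inr i)‖ ^ 2 := Finset.sum_nonneg fun i _ => by positivity
  have hB : 0 ≤ ∑ i, ‖b (Sum.inr i)‖ ^ 2 := Finset.sum_nonneg fun i _ => by positivity
  have hb0 : ‖b (Sum.inl 0)‖ ^ 2 = 0 := by
    by_contra hne0
    have hpos : 0 < ‖b (Sum.inl 0)‖ ^ 2 := lt_of_le_of_ne (by positivity) (Ne.symm hne0)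
    nlinarith [mul_le_mul_of_nonneg_left (sub_nonneg.1 hy') hA, mul_pos hv' hpos]
  have hB0 : ∑ i, ‖b (Sum.inr i)‖ ^ 2 = 0 := by linarith
  refine hne (one_tmul_injective (R := R) (c.ext_elem fun i => ?_))
  rw [map_zero, Finsupp.zero_apply]
  rcases i with i | i
  · fin_cases i
    simpa using hb0
  · have := (Finset.sum_eq_zero_iff_of_nonneg (fun i _ => by positivity)).1 hB0 i
      (Finset.mem_univ i)
    simpa using this

end Signature

end HermitianForm

end HermLat

/-! ### The classification of orbits. -/

namespace HermLat

open NormEuclidean (cj)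

section Classification

variable {R : Subalgebra ℤ ℂ} [NormEuclidean R] {α : R} {p : ℤ} {n : ℕ}
  {V : Type u} [AddCommGroup V] [Module R V] {h : HermitianForm R V}

namespace HermitianForm

/-- The form on `W` that makes a linear equivalence `V ≃ W` an isometry. -/
def transport {W : Type v} [AddCommGroup W] [Module R W] (h : HermitianForm R V) (E : V ≃ₗ[R] W) :
    HermitianForm R W where
  toFun x := (h (E.symm x)) ∘ₗ (E.symm : W →ₗ[R] V)
  conj_symm x y := h.conj_symm (E.symm x) (E.symm y)

omit [NormEuclidean R] in
theorem isometric_transport {W : Type v} [AddCommGroup W] [Module R W] (h : HermitianForm R V)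
    (E : V ≃ₗ[R] W) : Isometric h (h.transport E) := by
  refine ⟨E, fun x y => ?_⟩
  change h (E.symm (E x)) (E.symm (E y)) = h x y
  rw [E.symm_apply_apply, E.symm_apply_apply]

end HermitianForm

open HermitianForm

/-- This moves a lattice to the universe of the isometry classes, by transporting its form to a lift
of Rⁿ. -/
theorem exists_negDefModularLattice [Module.Free R V] [Module.Finite R V] (hα : IsModulus α p)
    (hrk : Module.finrank R V = n) (hn : h.IsNegDef) (hm : h.IsModular (α : ℂ)) :
    ∃ L : NegDefModularLattice.{v} R (α : ℂ) n, Isometric h L.form := by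
  let E : V ≃ₗ[R] ULift.{v} (Fin n → R) :=
    (Module.finBasisOfFinrankEq R V hrk).equivFun ≪≫ₗ ULift.moduleEquiv.symm
  have I := isometric_transport h E
  have hn' := hn.of_isometric I
  have : Module.Free R (ULift.{v} (Fin n → R)) := Module.Free.of_equiv E
  have : Module.Finite R (ULift.{v} (Fin n → R)) := Module.Finite.equiv E
  exact ⟨{
    carrier := ULift.{v} (Fin n → R)
    form := h.transport E
    rank_eq := by rw [← E.finrank_eq, hrk]
    negDef := hn'
    modular := (isModular_iff_perfect hα hn'.nondegenerate).2
      (((isModular_iff_perfect hα hn.nondegenerate).1 hm).of_isometric I) }, I⟩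

variable [Module.Free R V] [Module.Finite R V]

theorem perpQuot_properties (hα : IsModulus α p) (P : h.Perfect α) (H : h.Lorentzian) {e : V}
    (hprim : IsPrimitive (R := R) e) (he : h e e = 0) :
    Module.Free R (h.PerpQuot e) ∧ Module.Finite R (h.PerpQuot e) ∧
      Module.finrank R (h.PerpQuot e) + 2 = Module.finrank R V ∧
      (h.perpQuotForm e).IsNegDef ∧ (h.perpQuotForm e).IsModular (α : ℂ) := by
  obtain ⟨M, F, hF, rfl, hn, hP⟩ := P.exists_hypSum hα H hprim he
  have I := isometric_perpQuot hα.ne_zero F hF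
  have hn' := hn.of_isometric I
  have hP' := hP.of_isometric I
  obtain ⟨f, -⟩ := I
  have h1 : Module.Free R (h.PerpQuot (F (1, 0, 0))) := Module.Free.of_equiv f
  have h2 : Module.Finite R (h.PerpQuot (F (1, 0, 0))) := Module.Finite.equiv f
  refine ⟨h1, h2, ?_, hn', (isModular_iff_perfect hα hn'.nondegenerate).2 hP'⟩
  rw [← f.finrank_eq, ← F.finrank_eq, Module.finrank_prod, Module.finrank_prod,
    Module.finrank_self]
  ring

/-- Splitting off hyperbolic planes at e and e' identifies the quotients with the complements; an
isometry of these, extended by matching the planes, carries e to e'. -/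
theorem isometric_perpQuot_iff (hα : IsModulus α p) (P : h.Perfect α) (H : h.Lorentzian)
    {e e' : V} (hprim : IsPrimitive (R := R) e) (he : h e e = 0)
    (hprim' : IsPrimitive (R := R) e') (he' : h e' e' = 0) :
    Isometric (h.perpQuotForm e) (h.perpQuotForm e') ↔ ∃ g ∈ h.isometryGroup, g e = e' := by
  obtain ⟨M, F, hF, rfl, -, -⟩ := P.exists_hypSum hα H hprim he
  have I := isometric_perpQuot hα.ne_zero F hF
  constructor
  · intro J
    obtain ⟨M', F', hF', rfl, -, -⟩ := P.exists_hypSum hα H hprim' he'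
    have I' := isometric_perpQuot hα.ne_zero F' hF'
    obtain ⟨k, hk, hk1⟩ := hypSum_congr α ((I.trans J).trans I'.symm)
    refine ⟨F.symm ≪≫ₗ k ≪≫ₗ F', fun x y => ?_, ?_⟩
    · simp only [LinearEquiv.trans_apply]
      rw [hF', hk, ← hF, F.apply_symm_apply, F.apply_symm_apply]
    · simp only [LinearEquiv.trans_apply, F.symm_apply_apply, hk1]
  · rintro ⟨g, hg, rfl⟩
    exact I.symm.trans (isometric_perpQuot hα.ne_zero (F ≪≫ₗ g)
      fun x y => (hg _ _).trans (hF x y))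

/-- Every negative definite modular lattice of the right rank is some `e^⊥ / e`. -/
theorem exists_perpQuot_isometric {L : Type v} [AddCommGroup L] [Module R L] [Module.Free R L]
    [Module.Finite R L] {l : HermitianForm R L} (hα : IsModulus α p) (P : h.Perfect α)
    (H : h.Lorentzian) (hl : l.Perfect α) (hn : l.IsNegDef)
    (hrk : Module.finrank R L + 2 = Module.finrank R V) :
    ∃ e, IsPrimitive (R := R) e ∧ h e e = 0 ∧ Isometric (h.perpQuotForm e) l := by
  have hrk' : Module.finrank R (R × R × L) = Module.finrank R V := by
    rw [Module.finrank_prod, Module.finrank_prod, Module.finrank_self]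
    omega
  obtain ⟨F, hF⟩ := isometric_of_finrank_eq hα (hypSum_lorentzian hα hn) (hypSum_perfect hα hl)
    H P hrk' (by omega)
  refine ⟨F (1, 0, 0), fun a x hx => primitive_hypSum (L := L) a (F.symm x) ?_, ?_,
    (isometric_perpQuot hα.ne_zero F hF).symm⟩
  · rw [← map_smul, ← hx, F.symm_apply_apply]
  · rw [hF, hypSum_apply]
    simp

theorem perpQuot_classification (hα : IsModulus α p) {s : ℕ} (hs : 1 ≤ s)
    (hsig : h.HasSignature 1 s) (hmod : h.IsModular (α : ℂ)) :
    (∀ e ∈ h.primitiveIsotropic,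
      Module.Free R (h.PerpQuot e) ∧
      Module.Finite R (h.PerpQuot e) ∧
      Module.finrank R (h.PerpQuot e) = s - 1 ∧
      (h.perpQuotForm e).IsNegDef ∧
      (h.perpQuotForm e).IsModular (α : ℂ)) ∧
    ∃ Φ : h.IsotropicOrbits ≃ IsometryClasses.{v} R (α : ℂ) (s - 1),
      ∀ (e : h.primitiveIsotropic) (L : NegDefModularLattice.{v} R (α : ℂ) (s - 1)),
        Φ (Quotient.mk _ e) = Quotient.mk _ L ↔ Isometric (h.perpQuotForm e.1) L.form := by
  have H := hsig.lorentzian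
  have P := (isModular_iff_perfect hα hsig.nondegenerate).1 hmod
  have hrk := hsig.finrank_eq
  have part : ∀ e ∈ h.primitiveIsotropic,
      Module.Free R (h.PerpQuot e) ∧
      Module.Finite R (h.PerpQuot e) ∧
      Module.finrank R (h.PerpQuot e) = s - 1 ∧
      (h.perpQuotForm e).IsNegDef ∧
      (h.perpQuotForm e).IsModular (α : ℂ) := fun e he => by
    obtain ⟨h1, h2, h3, h4, h5⟩ := perpQuot_properties hα P H he.1 he.2
    exact ⟨h1, h2, by omega, h4, h5⟩
  refine ⟨part, ?_⟩
  have hL : ∀ e : h.primitiveIsotropic, ∃ L : NegDefModularLattice.{v} R (α : ℂ) (s - 1),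
      Isometric (h.perpQuotForm e.1) L.form := fun e => by
    obtain ⟨h1, h2, h3, h4, h5⟩ := part e.1 e.2
    exact exists_negDefModularLattice hα h3 h4 h5
  choose L hL using hL
  have hiff : ∀ e e' : h.primitiveIsotropic,
      (MulAction.orbitRel h.isometryGroup h.primitiveIsotropic) e e' ↔
        (isometrySetoid.{v} R (α : ℂ) (s - 1)) (L e) (L e') := by
    intro e e'
    rw [MulAction.orbitRel_apply, MulAction.mem_orbit_iff]
    have h1 := isometric_perpQuot_iff hα P H e'.2.1 e'.2.2 e.2.1 e.2.2
    constructor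
    · rintro ⟨g, hg⟩
      have h2 := h1.2 ⟨g.1, g.2, congrArg Subtype.val hg⟩
      exact ((hL e).symm.trans h2.symm).trans (hL e')
    · intro h2
      obtain ⟨g, hg, hge⟩ := h1.1 (((hL e').trans (Isometric.symm h2)).trans (hL e).symm)
      exact ⟨⟨g, hg⟩, Subtype.ext hge⟩
  let Φ₀ : h.IsotropicOrbits → IsometryClasses.{v} R (α : ℂ) (s - 1) :=
    Quotient.map L fun e e' he => (hiff e e').1 he
  have hΦ₀ : Function.Bijective Φ₀ := by
    constructor
    · intro x y
      induction x using Quotient.inductionOn with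
      | _ e =>
        induction y using Quotient.inductionOn with
        | _ e' => exact fun hxy => Quotient.sound ((hiff e e').2 (Quotient.exact hxy))
    · intro y
      induction y using Quotient.inductionOn with
      | _ M =>
        -- The ranks match because (s - 1) + 2 = s + 1, where truncated subtraction needs s ≥ 1.
        obtain ⟨e, hprim, he, I⟩ := exists_perpQuot_isometric hα P H
          ((isModular_iff_perfect hα M.negDef.nondegenerate).1 M.modular) M.negDef
          (by rw [M.rank_eq, hrk]; omega)
        exact ⟨Quotient.mk _ ⟨e, hprim, he⟩,
          Quotient.sound ((hL ⟨e, hprim, he⟩).symm.trans I)⟩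
  refine ⟨Equiv.ofBijective Φ₀ hΦ₀, fun e M => ⟨fun heq => ?_, fun I => ?_⟩⟩
  · exact (hL e).trans (Quotient.exact heq)
  · exact Quotient.sound ((hL e).symm.trans I)

end Classification

theorem exists_trace {k : ℕ} (hk : k = 3 ∨ k = 4 ∨ k = 6) {ζ : ℂ} (hζ : IsPrimitiveRoot ζ k) :
    ∃ t : ℤ, (t = -1 ∨ t = 0 ∨ t = 1) ∧ ζ ^ 2 = t * ζ - 1 := by
  have h0 := hζ.pow_eq_one
  rcases hk with rfl | rfl | rfl
  · refine ⟨-1, by norm_num, ?_⟩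
    have h1 : ζ - 1 ≠ 0 := sub_ne_zero.2 (hζ.ne_one (by norm_num))
    refine mul_left_cancel₀ h1 ?_
    push_cast
    linear_combination h0
  · refine ⟨0, by norm_num, ?_⟩
    have h1 : ζ ^ 2 - 1 ≠ 0 := sub_ne_zero.2 (hζ.pow_ne_one_of_pos_of_lt (by norm_num) (by norm_num))
    refine mul_left_cancel₀ h1 ?_
    push_cast
    linear_combination h0
  · refine ⟨1, by norm_num, ?_⟩
    have h1 : ζ ^ 3 - 1 ≠ 0 := sub_ne_zero.2 (hζ.pow_ne_one_of_pos_of_lt (by norm_num) (by norm_num))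
    have h2 : ζ ^ 2 - 1 ≠ 0 := sub_ne_zero.2 (hζ.pow_ne_one_of_pos_of_lt (by norm_num) (by norm_num))
    have h3 : ζ ^ 3 + 1 = 0 := mul_left_cancel₀ h1 (by linear_combination h0)
    have h4 : ζ + 1 ≠ 0 := fun h => h2 (by linear_combination (ζ - 1) * h)
    refine mul_left_cancel₀ h4 ?_
    push_cast
    linear_combination h3

/-- The polynomial X² - tX + 1 has negative discriminant t² - 4, so its roots are conjugate and not
real. -/
theorem conj_eq_of_sq {ζ : ℂ} {t : ℤ} (ht : t = -1 ∨ t = 0 ∨ t = 1) (h2 : ζ ^ 2 = t * ζ - 1) :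
    conj ζ = t - ζ ∧ ζ.im ≠ 0 := by
  have hre := congrArg Complex.re h2
  have him := congrArg Complex.im h2
  simp [pow_two] at hre him
  have ht2 : (t : ℝ) ^ 2 ≤ 1 := by
    rcases ht with rfl | rfl | rfl <;> norm_num
  have hne : ζ.im ≠ 0 := fun h0 => by
    rw [h0] at hre
    nlinarith [sq_nonneg (ζ.re - t / 2)]
  have h3 : 2 * ζ.re = t := mul_right_cancel₀ hne (by linarith)
  refine ⟨Complex.ext ?_ ?_, hne⟩
  · simp
    linarith
  · simp

end HermLat

theorem mainTheorem10 (k : ℕ) (hk : k = 3 ∨ k = 4 ∨ k = 6) (ζ : ℂ) (hζ : IsPrimitiveRoot ζ k)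
    (s : ℕ) (hs : 1 ≤ s)
    (Λ : Type u) [AddCommGroup Λ] [Module (HermLat.CycInt ζ) Λ]
    [Module.Free (HermLat.CycInt ζ) Λ] [Module.Finite (HermLat.CycInt ζ) Λ]
    (h : HermLat.HermitianForm (HermLat.CycInt ζ) Λ)
    (hsig : h.HasSignature 1 s) (hmod : h.IsModular (1 + ζ)) :
    (∀ e ∈ h.primitiveIsotropic,
      Module.Free (HermLat.CycInt ζ) (h.PerpQuot e) ∧
      Module.Finite (HermLat.CycInt ζ) (h.PerpQuot e) ∧
      Module.finrank (HermLat.CycInt ζ) (h.PerpQuot e) = s - 1 ∧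
      (h.perpQuotForm e).IsNegDef ∧
      (h.perpQuotForm e).IsModular (1 + ζ)) ∧
    ∃ Φ : h.IsotropicOrbits ≃ HermLat.IsometryClasses.{v} (HermLat.CycInt ζ) (1 + ζ) (s - 1),
      ∀ (e : h.primitiveIsotropic)
        (L : HermLat.NegDefModularLattice.{v} (HermLat.CycInt ζ) (1 + ζ) (s - 1)),
        Φ (Quotient.mk _ e) = Quotient.mk _ L ↔
          HermLat.Isometric (h.perpQuotForm e.1) L.form := by
  obtain ⟨t, ht, h2⟩ := HermLat.exists_trace hk hζ
  obtain ⟨hc, him⟩ := HermLat.conj_eq_of_sq ht h2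
  let := HermLat.normEuclidean ht h2 hc him
  exact HermLat.perpQuot_classification (HermLat.isModulus_one_add ht h2 hc him) hs hsig hmod
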